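/- Let $q\ge 2$, write $[q]=\{0,1,\dots,q-1\}$, and let $\oplus$ be an Abelian group operation on $\mathcal X=[q]$ with identity $0$. Let $\mathcal P_q\subset\mathbb R^q$ be the simplex of probability (row) vectors $v=(v_0,\dots,v_{q-1})$ and $\mathbf u=(1/q,\dots,1/q)$. For $v\in\mathbb R^q$ let $\mathrm{circ}_{\mathcal X}(v)\in\mathbb R^{q\times q}$ be the matrix with $(a,b)$ entry $v_{-a\oplus b}$ ($a,b\in[q]$); for $v\in\mathcal P_q$ it is the transition matrix of the additive noise channel $Y=X\oplus Z$ with noise $Z\sim v$ independent of $X$. For $x\in\mathcal X$ let $P_x$ be the permutation matrix with $(vP_x)_y=v_{x\oplus y}$, and let $P_q$ be the cyclic permutation matrix with $(v_0,\dots,v_{q-1})P_q=(v_{q-1},v_0,\dots,v_{q-2})$. For $\delta\in[0,1]$ put $$w_\delta=\Big(1-\delta,\tfrac{\delta}{q-1},\dots,\tfrac{\delta}{q-1}\Big)\in\mathcal P_q,\qquad W_\delta=\mathrm{circ}_{\mathcal X}(w_\delta).$$ For row stochastic matrices (channels) $W,V$ with the same input alphabet $[q]$: $W\succeq_{\mathsf{deg}}V$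 means $V=WA$ for some row stochastic matrix $A$; and $W\succeq_{\mathsf{ln}}V$ ($W$ is less noisy than $V$) means that $I(U;Y_W)\ge I(U;Y_V)$ for every joint distribution $P_{U,X}$ of a random variable $U$ with arbitrary range and a channel input $X\in[q]$, where $Y_W,Y_V$ are the outputs of $W,V$ on input $X$ and $U\to X\to(Y_W,Y_V)$ is a Markov chain. Define $$\mathcal L^{\mathsf{add}}_{W_\delta}=\{v\in\mathcal P_q: W_\delta\succeq_{\mathsf{ln}}\mathrm{circ}_{\mathcal X}(v)\},\qquad \mathcal D^{\mathsf{add}}_{W_\delta}=\{v\in\mathcal P_q: W_\delta\succeq_{\mathsf{deg}}\mathrm{circ}_{\mathcal X}(v)\}.$$ Then, for every $\delta\in\big[0,\frac{q-1}{q}\big]$ and with $$\gamma=\frac{1-\delta}{1-\delta+\frac{\delta}{(q-1)^2}},$$ we have $$\begin{aligned}\mathcal D^{\mathsf{add}}_{W_\delta}&=\mathrm{conv}\big(\{w_\delta P_q^k:k\in[q]\}\big)\\&\subseteq\mathrm{conv}\big(\{w_\delta P_q^k:k\in[q]\}\cup\{w_\gamma P_q^k:k\in[q]\}\big)\\&\subseteq\mathcal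 L^{\mathsf{add}}_{W_\delta}\subseteq\big\{v\in\mathcal P_q:\|v-\mathbf u\|_{\ell^2}\le\|w_\delta-\mathbf u\|_{\ell^2}\big\},\end{aligned}$$ where the first inclusion is strict if $q\ge 3$ and $\delta\in\big(0,\frac{q-1}{q}\big)$. Furthermore, $\mathcal L^{\mathsf{add}}_{W_\delta}$ is closed, convex, and invariant under the permutations $P_x$: if $v\in\mathcal L^{\mathsf{add}}_{W_\delta}$, then $vP_x\in\mathcal L^{\mathsf{add}}_{W_\delta}$ for every $x\in\mathcal X$. -/

import Mathlib

open scoped Matrix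

noncomputable section

namespace NoisyChannel

open MeasureTheory

/-- Row stochastic matrices: each row is a probability vector. -/
def IsStochastic {q r : ℕ} (W : Matrix (Fin q) (Fin r) ℝ) : Prop :=
  ∀ x, W x ∈ stdSimplex ℝ (Fin r)

/-- The joint law of `(U, Y)` when `(U, X)` has law `P`, `Y` is the output of the channel `W` on
input `X`, and `U → X → Y` is a Markov chain: given `(U, X) = (u, x)`, the pair `(U, Y)` equals
`(u, y)` with probability `W x y`. -/
def outputLaw {q r : ℕ} {𝒰 : Type*} [MeasurableSpace 𝒰] (P : Measure (𝒰 × Fin q))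
    (W : Matrix (Fin q) (Fin r) ℝ) : Measure (𝒰 × Fin r) :=
  P.bind fun p => ∑ y, ENNReal.ofReal (W p.2 y) • Measure.dirac (p.1, y)

/-- Mutual information of a joint law: the Kullback-Leibler divergence of the joint law from the
product of its marginals. -/
def mutualInfo {A B : Type*} [MeasurableSpace A] [MeasurableSpace B] (Q : Measure (A × B)) :
    ENNReal :=
  InformationTheory.klDiv Q (Q.fst.prod Q.snd)

/-- `W` is less noisy than `V`: `I(U; Y_W) ≥ I(U; Y_V)` for every joint law of `(U, X)`, where `U`
takes values in an arbitrary measurable space and `U → X → (Y_W, Y_V)` is a Markov chain. -/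
def LessNoisy {q r s : ℕ} (W : Matrix (Fin q) (Fin r) ℝ) (V : Matrix (Fin q) (Fin s) ℝ) : Prop :=
  ∀ (𝒰 : Type) [MeasurableSpace 𝒰] (P : Measure (𝒰 × Fin q)) [IsProbabilityMeasure P],
    mutualInfo (outputLaw P V) ≤ mutualInfo (outputLaw P W)

/-- `W` dominates `V` in the degradation order: `V` is a degraded version of `W`. -/
def DegradationDominates {q r s : ℕ} (W : Matrix (Fin q) (Fin r) ℝ)
    (V : Matrix (Fin q) (Fin s) ℝ) : Prop :=
  ∃ A : Matrix (Fin r) (Fin s) ℝ, IsStochastic A ∧ V = W * A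

section Group

/-! An Abelian group structure on the alphabet `{0, …, q - 1}` is given by a bijection `e` from
`Fin q` onto an additive commutative group `G`; `x ⊕ y` is `e.symm (e x + e y)`. -/

variable {q : ℕ} {G : Type*} [AddCommGroup G]

/-- The permutation matrix `P_x = [e_{x ⊕ 0} ⋯ e_{x ⊕ (q-1)}]` of a group element `x`. -/
def permMatrix (e : Fin q ≃ G) (x : Fin q) : Matrix (Fin q) (Fin q) ℝ :=
  Matrix.of fun i j => if i = e.symm (e x + e j) then 1 else 0

/-- The group circulant matrix of a vector, with `(a, b)` entry `x_{-a ⊕ b}`. It is the transition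
matrix of the additive noise channel with noise pmf `x`. -/
def circ (e : Fin q ≃ G) (x : Fin q → ℝ) : Matrix (Fin q) (Fin q) ℝ :=
  Matrix.of fun a b => x (e.symm (-(e a) + e b))

/-- Additive less noisy domination region of a channel. -/
def addLessNoisyRegion (e : Fin q ≃ G) (W : Matrix (Fin q) (Fin q) ℝ) : Set (Fin q → ℝ) :=
  {v | v ∈ stdSimplex ℝ (Fin q) ∧ LessNoisy W (circ e v)}

/-- Additive degradation region of a channel. -/
def addDegradationRegion (e : Fin q ≃ G) (W : Matrix (Fin q) (Fin q) ℝ) : Set (Fin q → ℝ) :=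
  {v | v ∈ stdSimplex ℝ (Fin q) ∧ DegradationDominates W (circ e v)}

end Group

/-- The noise pmf `w_δ = (1 - δ, δ/(q-1), …, δ/(q-1))`. -/
def symNoise (q : ℕ) (δ : ℝ) : Fin q → ℝ :=
  fun i => if (i : ℕ) = 0 then 1 - δ else δ / ((q : ℝ) - 1)

/-- The `q`-ary symmetric channel `W_δ`. -/
def symChannel {q : ℕ} {G : Type*} [AddCommGroup G] (e : Fin q ≃ G) (δ : ℝ) :
    Matrix (Fin q) (Fin q) ℝ :=
  circ e (symNoise q δ)

/-- The generator cyclic permutation matrix `P_q`: its `(a, b)` entry is `1` if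
`b - a ≡ 1 (mod q)`, and `0` otherwise. -/
def cyclicMatrix (q : ℕ) : Matrix (Fin q) (Fin q) ℝ :=
  Matrix.of fun a b => if ((b : ℕ) : ℤ) - ((a : ℕ) : ℤ) ≡ 1 [ZMOD (q : ℤ)] then 1 else 0

/-- The set `{w P_q^k : k ∈ {0, …, q-1}}` of cyclic shifts of a row vector. -/
def cyclicOrbit {q : ℕ} (w : Fin q → ℝ) : Set (Fin q → ℝ) :=
  Set.range fun k : Fin q => w ᵥ* (cyclicMatrix q ^ (k : ℕ))

/-- The uniform pmf on `q` letters. -/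
def uniformPmf (q : ℕ) : Fin q → ℝ := fun _ => 1 / (q : ℝ)

/-- The Euclidean norm of a vector in `ℝ^q`. -/
def l2norm {q : ℕ} (v : Fin q → ℝ) : ℝ := ‖(WithLp.toLp 2 v : EuclideanSpace ℝ (Fin q))‖

end NoisyChannel

end

open NoisyChannel

/-! With `U` of law `μ` and conditional input pmf `f u`, the information I(U;Y) is the Jensen gap,
for the random pmf `f u`, of the output negative entropy. Hence W is less noisy than V iff
negEntropy W - negEntropy V is convex on the simplex (`lessNoisy_iff_convexOn`); binary `U` already
suffices for one direction, and Jensen's inequality gives the other.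

Structure of the region: the Jensen gap of a channel is a sum of relative entropy terms, so by the
log-sum inequality it is convex in the channel, and it is continuous in the channel. This makes the
less noisy region convex and closed. Relabelling outputs does not change entropy, whence the
invariance.

Symmetric channels: put l = 1 - δq/(q-1), so that w_δ = l e_0 + (1-l)u. The parameter γ then
corresponds to -l/(1+(q-2)l). Since w_δ is constant off one letter, its cyclic shifts are the
mixtures with each point mass, whatever the group. A degrading matrix can be averaged over the
group, which gives the degradation region. For w_γ, convexity is checked through the Hessian, whose
diagonal coefficients have at most one negative entry at each interior pmf; Cauchy–Schwarz on the
hyperplane of zero-sum directions absorbs it (`sum_sq_mul_div_nonneg`). By convexity of the region,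
the convex hull follows.

The outer bound is the same Hessian condition at the uniform input in the direction e_0 - u, where
all output probabilities equal 1/q and the form becomes a squared Euclidean distance to u. -/

namespace NoisyChannel

open MeasureTheory ProbabilityTheory

/-! ### Mutual information as a Jensen gap of entropy -/

section JointLaw

variable {𝒰 : Type*} [MeasurableSpace 𝒰] {q r : ℕ}

/-- The law of `(U, X)` when `U` has law `μ` and, given `U = u`, `X` has pmf `f u`. -/
noncomputable def jointLaw (μ : Measure 𝒰) (f : 𝒰 → Fin q → ℝ) : Measure (𝒰 × Fin q) :=
  (μ.prod Measure.count).withDensity fun p => ENNReal.ofReal (f p.1 p.2)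

theorem measurable_uncurry_fin {β : Type*} [MeasurableSpace β] {f : 𝒰 → Fin q → β}
    (hf : ∀ x, Measurable fun u => f u x) :
    Measurable fun p : 𝒰 × Fin q => f p.1 p.2 :=
  measurable_from_prod_countable_left hf

theorem lintegral_jointLaw (μ : Measure 𝒰) [SFinite μ] {f : 𝒰 → Fin q → ℝ} (hf : Measurable f)
    {g : 𝒰 × Fin q → ENNReal} (hg : Measurable g) :
    ∫⁻ p, g p ∂(jointLaw μ f) = ∑ x, ∫⁻ u, ENNReal.ofReal (f u x) * g (u, x) ∂μ := by
  have hm : Measurable fun p : 𝒰 × Fin q => ENNReal.ofReal (f p.1 p.2) :=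
    (measurable_uncurry_fin fun x => (measurable_pi_apply x).comp hf).ennreal_ofReal
  rw [jointLaw, lintegral_withDensity_eq_lintegral_mul _ hm hg,
    lintegral_prod _ (hm.mul hg).aemeasurable, ← lintegral_finsetSum]
  · simp [lintegral_fintype]
  · intro x _
    exact ((measurable_pi_apply x).comp hf).ennreal_ofReal.mul (hg.comp measurable_prodMk_right)

/-- Disintegration needs regularity only of the second factor, here finite and nonempty, so 𝒰 may be
an arbitrary measurable space. -/
theorem exists_eq_jointLaw [NeZero q] (P : Measure (𝒰 × Fin q)) [IsProbabilityMeasure P] :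
    ∃ f : 𝒰 → Fin q → ℝ, Measurable f ∧ (∀ u, f u ∈ stdSimplex ℝ (Fin q)) ∧
      P = jointLaw P.fst f := by
  have hf : Measurable fun (u : 𝒰) (x : Fin q) => (P.condKernel u).real {x} := by
    refine measurable_pi_lambda _ fun x => ?_
    exact (Kernel.measurable_coe _ (measurableSet_singleton x)).ennreal_toReal
  refine ⟨fun u x => (P.condKernel u).real {x}, hf, fun u => ⟨fun x => measureReal_nonneg, ?_⟩, ?_⟩
  · rw [sum_measureReal_singleton]
    simp
  · refine Measure.ext_of_lintegral _ fun g hg => ?_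
    rw [lintegral_jointLaw _ hf hg]
    conv_lhs => rw [← P.disintegrate P.condKernel]
    rw [Measure.lintegral_compProd hg, ← lintegral_finsetSum]
    · simp [lintegral_fintype, mul_comm]
    · intro x _
      exact ((measurable_pi_apply x).comp hf).ennreal_ofReal.mul (hg.comp measurable_prodMk_right)

theorem measurable_vecMul {f : 𝒰 → Fin q → ℝ} (hf : Measurable f) (W : Matrix (Fin q) (Fin r) ℝ) :
    Measurable fun u => f u ᵥ* W :=
  (Continuous.measurable (by fun_prop : Continuous fun v : Fin q → ℝ => v ᵥ* W)).comp hf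

theorem outputLaw_jointLaw (μ : Measure 𝒰) [SFinite μ] {f : 𝒰 → Fin q → ℝ} (hf : Measurable f)
    (hf0 : ∀ u x, 0 ≤ f u x) {W : Matrix (Fin q) (Fin r) ℝ} (hW : ∀ x y, 0 ≤ W x y) :
    outputLaw (jointLaw μ f) W = jointLaw μ fun u => f u ᵥ* W := by
  have hfx : ∀ x, Measurable fun u => f u x := fun x => (measurable_pi_apply x).comp hf
  refine Measure.ext_of_lintegral _ fun g hg => ?_
  have hk : Measurable fun p : 𝒰 × Fin q =>
      ∑ y, ENNReal.ofReal (W p.2 y) • Measure.dirac (p.1, y) := by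
    refine Measure.measurable_of_measurable_coe _ fun s hs => ?_
    simp only [Measure.coe_finsetSum, Measure.coe_smul, Finset.sum_apply, Pi.smul_apply,
      smul_eq_mul, Measure.dirac_apply' _ hs]
    refine Finset.measurable_sum _ fun y _ => ?_
    refine Measurable.mul ?_ ?_
    · exact (measurable_of_finite fun x : Fin q => ENNReal.ofReal (W x y)).comp measurable_snd
    · exact (measurable_const.indicator hs).comp (measurable_fst.prodMk measurable_const)
  have hG : Measurable fun p : 𝒰 × Fin q => ∑ y, ENNReal.ofReal (W p.2 y) * g (p.1, y) := by
    refine Finset.measurable_sum _ fun y _ => Measurable.mul ?_ ?_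
    · exact (measurable_of_finite fun x : Fin q => ENNReal.ofReal (W x y)).comp measurable_snd
    · exact hg.comp (measurable_fst.prodMk measurable_const)
  rw [outputLaw, Measure.lintegral_bind hk.aemeasurable hg.aemeasurable]
  simp only [lintegral_finsetSum_measure, lintegral_smul_measure, lintegral_dirac' _ hg,
    smul_eq_mul]
  rw [lintegral_jointLaw _ hf hG, lintegral_jointLaw _ (measurable_vecMul hf W) hg,
    ← lintegral_finsetSum, ← lintegral_finsetSum]
  · refine lintegral_congr fun u => ?_
    simp only [Finset.mul_sum]
    rw [Finset.sum_comm]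
    refine Finset.sum_congr rfl fun y _ => ?_
    rw [Matrix.vecMul, dotProduct,
      ENNReal.ofReal_sum_of_nonneg fun x _ => mul_nonneg (hf0 u x) (hW x y), Finset.sum_mul]
    refine Finset.sum_congr rfl fun x _ => ?_
    rw [ENNReal.ofReal_mul (hf0 u x), mul_assoc]
  · intro y _
    exact ((measurable_pi_apply y).comp (measurable_vecMul hf W)).ennreal_ofReal.mul
      (hg.comp measurable_prodMk_right)
  · intro x _
    exact (hfx x).ennreal_ofReal.mul (hG.comp measurable_prodMk_right)

theorem integrable_of_mem_stdSimplex {E : Type*} [NormedAddCommGroup E] (μ : Measure 𝒰)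
    [IsFiniteMeasure μ] {f : 𝒰 → Fin q → ℝ} (hf : Measurable f)
    (hfs : ∀ u, f u ∈ stdSimplex ℝ (Fin q)) {φ : (Fin q → ℝ) → E} (hφ : Continuous φ) :
    Integrable (fun u => φ (f u)) μ := by
  obtain ⟨C, hC⟩ := (isCompact_stdSimplex ℝ (Fin q)).exists_bound_of_continuousOn hφ.continuousOn
  exact Integrable.of_bound (hφ.comp_aestronglyMeasurable hf.aestronglyMeasurable) C
    (Filter.Eventually.of_forall fun u => hC _ (hfs u))

/-- The law of `X` when `U` has law `μ` and, given `U = u`, `X` has pmf `f u`. -/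
noncomputable def meanPmf (μ : Measure 𝒰) (f : 𝒰 → Fin q → ℝ) : Fin q → ℝ := fun x => ∫ u, f u x ∂μ

theorem meanPmf_mem_stdSimplex (μ : Measure 𝒰) [IsProbabilityMeasure μ] {f : 𝒰 → Fin q → ℝ}
    (hf : Measurable f) (hfs : ∀ u, f u ∈ stdSimplex ℝ (Fin q)) :
    meanPmf μ f ∈ stdSimplex ℝ (Fin q) := by
  refine ⟨fun x => integral_nonneg fun u => (hfs u).1 x, ?_⟩
  simp only [meanPmf]
  rw [← integral_finsetSum _ fun x _ =>
    integrable_of_mem_stdSimplex μ hf hfs (continuous_apply x)]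
  simp [(hfs _).2]

theorem meanPmf_vecMul (μ : Measure 𝒰) [IsProbabilityMeasure μ] {f : 𝒰 → Fin q → ℝ}
    (hf : Measurable f) (hfs : ∀ u, f u ∈ stdSimplex ℝ (Fin q)) (W : Matrix (Fin q) (Fin r) ℝ) :
    meanPmf μ (fun u => f u ᵥ* W) = meanPmf μ f ᵥ* W := by
  ext y
  simp only [meanPmf, Matrix.vecMul, dotProduct]
  rw [integral_finsetSum _ fun x _ =>
    (integrable_of_mem_stdSimplex μ hf hfs (continuous_apply x)).mul_const _]
  simp only [integral_mul_const]

theorem fst_jointLaw (μ : Measure 𝒰) [SFinite μ] {f : 𝒰 → Fin q → ℝ} (hf : Measurable f)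
    (hfs : ∀ u, f u ∈ stdSimplex ℝ (Fin q)) : (jointLaw μ f).fst = μ := by
  refine Measure.ext_of_lintegral _ fun g hg => ?_
  rw [Measure.fst, lintegral_map hg measurable_fst,
    lintegral_jointLaw _ hf (g := fun p => g p.1) (hg.comp measurable_fst), ← lintegral_finsetSum]
  · refine lintegral_congr fun u => ?_
    simp only
    rw [← Finset.sum_mul, ← ENNReal.ofReal_sum_of_nonneg fun x _ => (hfs u).1 x, (hfs u).2]
    simp
  · intro x _
    exact ((measurable_pi_apply x).comp hf).ennreal_ofReal.mul hg

theorem isProbabilityMeasure_jointLaw (μ : Measure 𝒰)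
    [IsProbabilityMeasure μ] {f : 𝒰 → Fin q → ℝ} (hf : Measurable f)
    (hfs : ∀ u, f u ∈ stdSimplex ℝ (Fin q)) : IsProbabilityMeasure (jointLaw μ f) := by
  refine ⟨?_⟩
  rw [← Measure.fst_univ, fst_jointLaw μ hf hfs]
  simp

theorem fst_prod_snd_jointLaw (μ : Measure 𝒰) [IsProbabilityMeasure μ] {f : 𝒰 → Fin q → ℝ}
    (hf : Measurable f) (hfs : ∀ u, f u ∈ stdSimplex ℝ (Fin q)) :
    (jointLaw μ f).fst.prod (jointLaw μ f).snd = jointLaw μ fun _ => meanPmf μ f := by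
  have := isProbabilityMeasure_jointLaw μ hf hfs
  rw [fst_jointLaw μ hf hfs]
  refine Measure.ext_of_lintegral _ fun g hg => ?_
  rw [lintegral_prod_symm _ hg.aemeasurable, lintegral_jointLaw _ measurable_const hg,
    Measure.snd, lintegral_map hg.lintegral_prod_left' measurable_snd,
    lintegral_jointLaw _ hf (g := fun p => ∫⁻ u, g (u, p.2) ∂μ)
      (hg.lintegral_prod_left'.comp measurable_snd)]
  refine Finset.sum_congr rfl fun x _ => ?_
  have hx : Measurable fun u => f u x := (measurable_pi_apply x).comp hf
  simp only
  rw [lintegral_mul_const _ hx.ennreal_ofReal, lintegral_const_mul _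
    (f := fun u => g (u, x)) (hg.comp measurable_prodMk_right), meanPmf,
    ofReal_integral_eq_lintegral_ofReal (integrable_of_mem_stdSimplex μ hf hfs (continuous_apply x))
    (Filter.Eventually.of_forall fun u => (hfs u).1 x)]

theorem jointLaw_eq_withDensity (μ : Measure 𝒰) [IsProbabilityMeasure μ] {f : 𝒰 → Fin q → ℝ}
    (hf : Measurable f) (hfs : ∀ u, f u ∈ stdSimplex ℝ (Fin q)) :
    jointLaw μ f = (jointLaw μ fun _ => meanPmf μ f).withDensity
      fun p => ENNReal.ofReal (f p.1 p.2 / meanPmf μ f p.2) := by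
  have hm : Measurable fun p : 𝒰 × Fin q => ENNReal.ofReal (f p.1 p.2 / meanPmf μ f p.2) :=
    (measurable_uncurry_fin (f := fun u x => f u x / meanPmf μ f x) fun x =>
      ((measurable_pi_apply x).comp hf).div_const _).ennreal_ofReal
  refine Measure.ext_of_lintegral _ fun g hg => ?_
  rw [lintegral_withDensity_eq_lintegral_mul _ hm hg, lintegral_jointLaw _ hf hg,
    lintegral_jointLaw _ measurable_const (hm.mul hg)]
  refine Finset.sum_congr rfl fun x _ => lintegral_congr_ae ?_
  have hnn : 0 ≤ meanPmf μ f x := (meanPmf_mem_stdSimplex μ hf hfs).1 x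
  rcases hnn.eq_or_lt with h0 | hpos
  -- A letter of mean probability zero has conditional probability zero almost surely, so the value
  -- 0 of division by 0 does no harm.
  · have hz : (fun u => f u x) =ᵐ[μ] 0 :=
      (integral_eq_zero_iff_of_nonneg (fun u => (hfs u).1 x)
        (integrable_of_mem_stdSimplex μ hf hfs (continuous_apply x))).1 h0.symm
    filter_upwards [hz] with u hu
    simp only [Pi.zero_apply] at hu
    simp [hu, ← h0]
  · refine Filter.Eventually.of_forall fun u => ?_
    simp only [Pi.mul_apply]
    rw [← mul_assoc, ← ENNReal.ofReal_mul hnn, mul_div_cancel₀ _ hpos.ne']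

theorem mul_klFun_div {a m : ℝ} (h : m = 0 → a = 0) :
    m * InformationTheory.klFun (a / m) = a * Real.log a - a * Real.log m + m - a := by
  by_cases hm : m = 0
  · simp [hm, h hm]
  by_cases ha : a = 0
  · simp [ha, InformationTheory.klFun]
  rw [InformationTheory.klFun, Real.log_div ha hm]
  field_simp

/-- The density with respect to the product of the marginals is f u x / mean x. Integrating `klFun`
of it letter by letter, the linear terms m - a cancel because m is the mean of a. -/
theorem mutualInfo_jointLaw (μ : Measure 𝒰) [IsProbabilityMeasure μ] {f : 𝒰 → Fin q → ℝ}
    (hf : Measurable f) (hfs : ∀ u, f u ∈ stdSimplex ℝ (Fin q)) :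
    mutualInfo (jointLaw μ f) = ENNReal.ofReal
      ((∫ u, ∑ x, f u x * Real.log (f u x) ∂μ) -
        ∑ x, meanPmf μ f x * Real.log (meanPmf μ f x)) := by
  have hms := meanPmf_mem_stdSimplex μ hf hfs
  have h1 := isProbabilityMeasure_jointLaw μ hf hfs
  have h2 := isProbabilityMeasure_jointLaw μ (f := fun _ => meanPmf μ f) measurable_const fun _ => hms
  have hd : Measurable fun p : 𝒰 × Fin q => f p.1 p.2 / meanPmf μ f p.2 :=
    (measurable_uncurry_fin (f := fun u x => f u x / meanPmf μ f x) fun x =>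
      ((measurable_pi_apply x).comp hf).div_const _)
  have hdn : ∀ u x, 0 ≤ f u x / meanPmf μ f x := fun u x => div_nonneg ((hfs u).1 x) (hms.1 x)
  have hac : jointLaw μ f ≪ jointLaw μ fun _ => meanPmf μ f := by
    rw [jointLaw_eq_withDensity μ hf hfs]
    exact withDensity_absolutelyContinuous _ _
  have hrn : (jointLaw μ f).rnDeriv (jointLaw μ fun _ => meanPmf μ f)
      =ᵐ[jointLaw μ fun _ => meanPmf μ f]
        fun p => ENNReal.ofReal (f p.1 p.2 / meanPmf μ f p.2) := by
    conv_lhs => rw [jointLaw_eq_withDensity μ hf hfs]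
    exact Measure.rnDeriv_withDensity _ hd.ennreal_ofReal
  have hkl : Measurable fun p : 𝒰 × Fin q =>
      ENNReal.ofReal (InformationTheory.klFun (f p.1 p.2 / meanPmf μ f p.2)) :=
    (InformationTheory.measurable_klFun.comp hd).ennreal_ofReal
  have hint : ∀ x, Integrable (fun u => f u x * Real.log (f u x)) μ := fun x =>
    integrable_of_mem_stdSimplex μ hf hfs (φ := fun v => v x * Real.log (v x))
      (Real.continuous_mul_log.comp (continuous_apply x))
  have hint' : ∀ x, Integrable (fun u => f u x) μ := fun x =>
    integrable_of_mem_stdSimplex μ hf hfs (continuous_apply x)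
  rw [mutualInfo, fst_prod_snd_jointLaw μ hf hfs,
    InformationTheory.klDiv_eq_lintegral_klFun_of_ac hac,
    lintegral_congr_ae (g := fun p =>
      ENNReal.ofReal (InformationTheory.klFun (f p.1 p.2 / meanPmf μ f p.2)))
      (by filter_upwards [hrn] with p hp; rw [hp, ENNReal.toReal_ofReal (hdn _ _)]),
    lintegral_jointLaw μ measurable_const hkl, integral_finsetSum _ fun x _ => hint x,
    ← Finset.sum_sub_distrib, ENNReal.ofReal_sum_of_nonneg]
  all_goals
    have key : ∀ x, (∫ u, f u x * Real.log (f u x) ∂μ) -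
          meanPmf μ f x * Real.log (meanPmf μ f x) =
        ∫ u, meanPmf μ f x * InformationTheory.klFun (f u x / meanPmf μ f x) ∂μ ∧
        Integrable (fun u => meanPmf μ f x * InformationTheory.klFun (f u x / meanPmf μ f x)) μ := by
      intro x
      have hz : (fun u => meanPmf μ f x * InformationTheory.klFun (f u x / meanPmf μ f x)) =ᵐ[μ]
          fun u => f u x * Real.log (f u x) - f u x * Real.log (meanPmf μ f x) +
            meanPmf μ f x - f u x := by
        by_cases h0 : meanPmf μ f x = 0
        · have hz : (fun u => f u x) =ᵐ[μ] 0 :=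
            (integral_eq_zero_iff_of_nonneg (fun u => (hfs u).1 x) (hint' x)).1 h0
          filter_upwards [hz] with u hu
          exact mul_klFun_div fun _ => hu
        · exact Filter.Eventually.of_forall fun u => mul_klFun_div fun h => absurd h h0
      have hi1 := (hint x).sub ((hint' x).mul_const (Real.log (meanPmf μ f x)))
      have hi2 := hi1.add (integrable_const (meanPmf μ f x))
      refine ⟨?_, (integrable_congr hz).2 (hi2.sub (hint' x))⟩
      rw [integral_congr_ae hz]
      rw [integral_sub (by exact hi2) (hint' x), integral_add (by exact hi1) (integrable_const _),
        integral_sub (hint x) ((hint' x).mul_const _), integral_mul_const]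
      simp [meanPmf]
  · refine Finset.sum_congr rfl fun x _ => ?_
    rw [(key x).1, ofReal_integral_eq_lintegral_ofReal (key x).2]
    · refine lintegral_congr fun u => ?_
      rw [ENNReal.ofReal_mul (hms.1 x)]
    · exact Filter.Eventually.of_forall fun u =>
        mul_nonneg (hms.1 x) (InformationTheory.klFun_nonneg (hdn u x))
  · intro x _
    rw [(key x).1]
    exact integral_nonneg fun u =>
      mul_nonneg (hms.1 x) (InformationTheory.klFun_nonneg (hdn u x))

end JointLaw

/-! ### The less noisy order as convexity, and its stability under mixtures -/

section Criterion

variable {q r s : ℕ}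

/-- The negative entropy of the output of the channel `W` when the input has pmf `p`. -/
noncomputable def negEntropy (W : Matrix (Fin q) (Fin r) ℝ) (p : Fin q → ℝ) : ℝ :=
  ∑ y, (p ᵥ* W) y * Real.log ((p ᵥ* W) y)

theorem continuous_negEntropy (W : Matrix (Fin q) (Fin r) ℝ) : Continuous (negEntropy W) := by
  unfold negEntropy
  refine continuous_finsetSum _ fun y _ => Real.continuous_mul_log.comp ?_
  exact (continuous_apply y).comp (by fun_prop : Continuous fun p : Fin q → ℝ => p ᵥ* W)

theorem vecMul_mem_stdSimplex {W : Matrix (Fin q) (Fin r) ℝ} (hW : IsStochastic W)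
    {p : Fin q → ℝ} (hp : p ∈ stdSimplex ℝ (Fin q)) : p ᵥ* W ∈ stdSimplex ℝ (Fin r) := by
  simp only [stdSimplex, Set.mem_ofPred_eq, Matrix.vecMul, dotProduct]
  refine ⟨fun y => Finset.sum_nonneg fun x _ => mul_nonneg (hp.1 x) ((hW x).1 y), ?_⟩
  rw [Finset.sum_comm]
  simp [← Finset.mul_sum, (hW _).2, hp.2]

theorem convexOn_negEntropy {W : Matrix (Fin q) (Fin r) ℝ} (hW : IsStochastic W) :
    ConvexOn ℝ (stdSimplex ℝ (Fin q)) (negEntropy W) := by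
  refine ⟨convex_stdSimplex ℝ _, fun p hp p' hp' a b ha hb hab => ?_⟩
  simp only [negEntropy, smul_eq_mul, Finset.mul_sum]
  rw [← Finset.sum_add_distrib]
  refine Finset.sum_le_sum fun y _ => ?_
  rw [Matrix.add_vecMul, Matrix.smul_vecMul, Matrix.smul_vecMul]
  exact Real.convexOn_mul_log.2 ((vecMul_mem_stdSimplex hW hp).1 y)
    ((vecMul_mem_stdSimplex hW hp').1 y) ha hb hab

theorem mutualInfo_outputLaw {𝒰 : Type*} [MeasurableSpace 𝒰] (μ : Measure 𝒰)
    [IsProbabilityMeasure μ] {f : 𝒰 → Fin q → ℝ} (hf : Measurable f)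
    (hfs : ∀ u, f u ∈ stdSimplex ℝ (Fin q)) {W : Matrix (Fin q) (Fin r) ℝ}
    (hW : IsStochastic W) :
    mutualInfo (outputLaw (jointLaw μ f) W) =
      ENNReal.ofReal ((∫ u, negEntropy W (f u) ∂μ) - negEntropy W (meanPmf μ f)) := by
  rw [outputLaw_jointLaw μ hf (fun u => (hfs u).1) (fun x => (hW x).1),
    mutualInfo_jointLaw μ (measurable_vecMul hf W) (fun u => vecMul_mem_stdSimplex hW (hfs u)),
    meanPmf_vecMul μ hf hfs]
  rfl

/-- Characterization of the less noisy order: `W` is less noisy than `V` iff the entropy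
difference `H(Y_V) - H(Y_W)` is a convex function of the input pmf. -/
theorem lessNoisy_iff_convexOn [NeZero q] {W : Matrix (Fin q) (Fin r) ℝ}
    {V : Matrix (Fin q) (Fin s) ℝ} (hW : IsStochastic W) (hV : IsStochastic V) :
    LessNoisy W V ↔
      ConvexOn ℝ (stdSimplex ℝ (Fin q)) fun p => negEntropy W p - negEntropy V p := by
  constructor
  · intro h
    refine ⟨convex_stdSimplex ℝ _, fun p hp p' hp' a b ha hb hab => ?_⟩
    -- A binary `U` choosing p with probability a and p' with probability b turns the information
    -- inequality into the two-point convexity inequality.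
    let μ : Measure Bool :=
      ENNReal.ofReal a • Measure.dirac true + ENNReal.ofReal b • Measure.dirac false
    have hμ : IsProbabilityMeasure μ := by
      refine ⟨?_⟩
      simp [μ, ← ENNReal.ofReal_add ha hb, hab]
    let f : Bool → Fin q → ℝ := fun u => if u then p else p'
    have hf : Measurable f := measurable_of_finite f
    have hfs : ∀ u, f u ∈ stdSimplex ℝ (Fin q) := by
      intro u
      cases u
      · exact hp'
      · exact hp
    have hint : ∀ φ : Bool → ℝ, ∫ u, φ u ∂μ = a * φ true + b * φ false := by
      intro φ
      have hd : ∀ (c : ℝ) (u : Bool), Integrable φ (ENNReal.ofReal c • Measure.dirac u) :=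
        fun c u => (integrable_dirac (by simp)).smul_measure ENNReal.ofReal_ne_top
      rw [integral_add_measure (hd a true) (hd b false)]
      simp [integral_smul_measure, ENNReal.toReal_ofReal ha, ENNReal.toReal_ofReal hb]
    have hmean : meanPmf μ f = a • p + b • p' := by
      ext x
      simp [meanPmf, hint, f]
    have := isProbabilityMeasure_jointLaw μ hf hfs
    have key := h Bool (jointLaw μ f)
    rw [mutualInfo_outputLaw μ hf hfs hW, mutualInfo_outputLaw μ hf hfs hV, hint, hint,
      hmean] at key
    have hgap := (convexOn_negEntropy hW).2 hp hp' ha hb hab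
    simp only [smul_eq_mul] at hgap
    -- `ENNReal.ofReal` truncates at 0, so the comparison passes to the reals only because the gap
    -- of W is nonnegative.
    rw [ENNReal.ofReal_le_ofReal_iff (by simpa [f] using hgap)] at key
    simp only [f, if_true, smul_eq_mul, Bool.false_eq_true, if_false] at key ⊢
    linarith
  · intro h 𝒰 _ P _
    obtain ⟨f, hf, hfs, hP⟩ := exists_eq_jointLaw P
    rw [hP, mutualInfo_outputLaw _ hf hfs hW, mutualInfo_outputLaw _ hf hfs hV]
    refine ENNReal.ofReal_le_ofReal ?_
    have hW' := continuous_negEntropy W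
    have hV' := continuous_negEntropy V
    have hi := integrable_of_mem_stdSimplex P.fst hf hfs continuous_id
    have hJ := h.map_integral_le (μ := P.fst) (hW'.sub hV').continuousOn
      (isClosed_stdSimplex ℝ (Fin q)) (Filter.Eventually.of_forall hfs) hi
      (integrable_of_mem_stdSimplex P.fst hf hfs (hW'.sub hV'))
    rw [integral_sub (integrable_of_mem_stdSimplex P.fst hf hfs hW')
      (integrable_of_mem_stdSimplex P.fst hf hfs hV')] at hJ
    have hmean : ∫ u, f u ∂P.fst = meanPmf P.fst f := by
      ext x
      exact eval_integral
        (fun x => integrable_of_mem_stdSimplex P.fst hf hfs (continuous_apply x)) x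
    rw [hmean] at hJ
    linarith

/-- The gap in Jensen's inequality for the output negative entropy of a channel. -/
noncomputable def jensenGap (W : Matrix (Fin q) (Fin r) ℝ) (p p' : Fin q → ℝ) (a b : ℝ) : ℝ :=
  a * negEntropy W p + b * negEntropy W p' - negEntropy W (a • p + b • p')

theorem lessNoisy_iff_jensenGap_le [NeZero q] {W : Matrix (Fin q) (Fin r) ℝ}
    {V : Matrix (Fin q) (Fin s) ℝ} (hW : IsStochastic W) (hV : IsStochastic V) :
    LessNoisy W V ↔ ∀ p ∈ stdSimplex ℝ (Fin q), ∀ p' ∈ stdSimplex ℝ (Fin q), ∀ a b : ℝ,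
      0 ≤ a → 0 ≤ b → a + b = 1 → jensenGap V p p' a b ≤ jensenGap W p p' a b := by
  rw [lessNoisy_iff_convexOn hW hV]
  simp only [jensenGap]
  constructor
  · intro h p hp p' hp' a b ha hb hab
    have := h.2 hp hp' ha hb hab
    simp only [smul_eq_mul] at this
    linarith
  · intro h
    refine ⟨convex_stdSimplex ℝ _, fun p hp p' hp' a b ha hb hab => ?_⟩
    have := h p hp p' hp' a b ha hb hab
    simp only [smul_eq_mul]
    linarith

/-- This is log x ≤ x - 1 at x = Am/(Ma), multiplied by a. With A and M the sums of the a's and of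
the m's, the error terms Am/M - a add up to zero, which yields the log-sum inequality. -/
theorem mul_log_sub_mul_log_le {a m A M : ℝ} (ha : 0 ≤ a) (hm : 0 ≤ m) (h : m = 0 → a = 0)
    (hA : a ≤ A) (hM : m ≤ M) :
    a * Real.log A - a * Real.log M ≤ a * Real.log a - a * Real.log m + (A * m / M - a) := by
  rcases ha.eq_or_lt with rfl | ha
  · simp only [zero_mul, sub_self, sub_zero, zero_add]
    exact div_nonneg (mul_nonneg hA hm) (hm.trans hM)
  have hm : 0 < m := hm.lt_of_ne fun h0 => ha.ne' (h h0.symm)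
  have hA := ha.trans_le hA
  have hM := hm.trans_le hM
  have hlog := Real.log_le_sub_one_of_pos (x := (A * m) / (M * a)) (by positivity)
  rw [Real.log_div (by positivity) (by positivity), Real.log_mul hA.ne' hm.ne',
    Real.log_mul hM.ne' ha.ne'] at hlog
  have := mul_le_mul_of_nonneg_left hlog ha.le
  have h2 : a * (A * m / (M * a) - 1) = A * m / M - a := by field_simp
  rw [h2] at this
  linarith

/-- The log-sum inequality for two summands. -/
theorem log_sum_inequality {a₁ a₂ m₁ m₂ : ℝ} (ha₁ : 0 ≤ a₁) (ha₂ : 0 ≤ a₂) (hm₁ : 0 ≤ m₁)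
    (hm₂ : 0 ≤ m₂) (h₁ : m₁ = 0 → a₁ = 0) (h₂ : m₂ = 0 → a₂ = 0) :
    (a₁ + a₂) * Real.log (a₁ + a₂) - (a₁ + a₂) * Real.log (m₁ + m₂) ≤
      (a₁ * Real.log a₁ - a₁ * Real.log m₁) + (a₂ * Real.log a₂ - a₂ * Real.log m₂) := by
  have e₁ := mul_log_sub_mul_log_le (A := a₁ + a₂) (M := m₁ + m₂) ha₁ hm₁ h₁
    (by linarith) (by linarith)
  have e₂ := mul_log_sub_mul_log_le (A := a₁ + a₂) (M := m₁ + m₂) ha₂ hm₂ h₂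
    (by linarith) (by linarith)
  have e₃ : (a₁ + a₂) * m₁ / (m₁ + m₂) + (a₁ + a₂) * m₂ / (m₁ + m₂) = a₁ + a₂ := by
    rcases (add_nonneg hm₁ hm₂).eq_or_lt with h0 | h0
    · have z₁ := h₁ (by linarith)
      have z₂ := h₂ (by linarith)
      simp [z₁, z₂]
    · field_simp
  linarith

theorem mul_log_smul {c a m : ℝ} (h : m = 0 → a = 0) :
    (c * a) * Real.log (c * a) - (c * a) * Real.log (c * m) =
      c * (a * Real.log a - a * Real.log m) := by
  by_cases hc : c = 0
  · simp [hc]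
  by_cases ha : a = 0
  · simp [ha]
  rw [Real.log_mul hc ha, Real.log_mul hc fun h0 => ha (h h0)]
  ring

/-- With m = sa + tb, the Jensen gap of x log x is s(a log a - a log m) + t(b log b - b log m). Each
term is jointly convex in its two arguments by the log-sum inequality, and m is linear in (a, b). -/
theorem jensenGap_mul_log_convex {s t α β a₁ b₁ a₂ b₂ : ℝ} (hs : 0 ≤ s) (ht : 0 ≤ t)
    (hα : 0 ≤ α) (hβ : 0 ≤ β) (ha₁ : 0 ≤ a₁) (hb₁ : 0 ≤ b₁) (ha₂ : 0 ≤ a₂) (hb₂ : 0 ≤ b₂) :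
    s * ((α * a₁ + β * a₂) * Real.log (α * a₁ + β * a₂)) +
        t * ((α * b₁ + β * b₂) * Real.log (α * b₁ + β * b₂)) -
        (s * (α * a₁ + β * a₂) + t * (α * b₁ + β * b₂)) *
          Real.log (s * (α * a₁ + β * a₂) + t * (α * b₁ + β * b₂)) ≤
      α * (s * (a₁ * Real.log a₁) + t * (b₁ * Real.log b₁) -
          (s * a₁ + t * b₁) * Real.log (s * a₁ + t * b₁)) +
        β * (s * (a₂ * Real.log a₂) + t * (b₂ * Real.log b₂) -
          (s * a₂ + t * b₂) * Real.log (s * a₂ + t * b₂)) := by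
  -- The bound w x ≤ m supplies, for w > 0, the absolute continuity m = 0 → x = 0; for w = 0 both
  -- sides vanish.
  have main : ∀ {w x₁ x₂ m₁ m₂ : ℝ}, 0 ≤ w → 0 ≤ x₁ → 0 ≤ x₂ → w * x₁ ≤ m₁ → w * x₂ ≤ m₂ →
      w * ((α * x₁ + β * x₂) * Real.log (α * x₁ + β * x₂) -
        (α * x₁ + β * x₂) * Real.log (α * m₁ + β * m₂)) ≤
      α * (w * (x₁ * Real.log x₁ - x₁ * Real.log m₁)) +
        β * (w * (x₂ * Real.log x₂ - x₂ * Real.log m₂)) := by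
    intro w x₁ x₂ m₁ m₂ hw hx₁ hx₂ hm₁ hm₂
    rcases hw.eq_or_lt with rfl | hw
    · simp
    have z : ∀ {x m : ℝ}, 0 ≤ x → w * x ≤ m → m = 0 → x = 0 := by
      rintro x m hx hm rfl
      nlinarith
    have z' : ∀ {c x m : ℝ}, 0 ≤ x → w * x ≤ m → c * m = 0 → c * x = 0 := by
      intro c x m hx hm h
      rcases mul_eq_zero.1 h with h | h
      · simp [h]
      · simp [z hx hm h]
    have n₁ : 0 ≤ m₁ := (mul_nonneg hw.le hx₁).trans hm₁
    have n₂ : 0 ≤ m₂ := (mul_nonneg hw.le hx₂).trans hm₂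
    have := log_sum_inequality (mul_nonneg hα hx₁) (mul_nonneg hβ hx₂) (mul_nonneg hα n₁)
      (mul_nonneg hβ n₂) (z' hx₁ hm₁) (z' hx₂ hm₂)
    rw [mul_log_smul (z hx₁ hm₁), mul_log_smul (z hx₂ hm₂)] at this
    have := mul_le_mul_of_nonneg_left this hw.le
    linarith
  have e₁ := main hs ha₁ ha₂ (le_add_of_nonneg_right (mul_nonneg ht hb₁) : _ ≤ s * a₁ + t * b₁)
    (le_add_of_nonneg_right (mul_nonneg ht hb₂) : _ ≤ s * a₂ + t * b₂)
  have e₂ := main ht hb₁ hb₂ (le_add_of_nonneg_left (mul_nonneg hs ha₁) : _ ≤ s * a₁ + t * b₁)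
    (le_add_of_nonneg_left (mul_nonneg hs ha₂) : _ ≤ s * a₂ + t * b₂)
  have e₃ : s * (α * a₁ + β * a₂) + t * (α * b₁ + β * b₂) =
      α * (s * a₁ + t * b₁) + β * (s * a₂ + t * b₂) := by ring
  rw [e₃]
  linarith

theorem jensenGap_eq_sum (W : Matrix (Fin q) (Fin r) ℝ) (p p' : Fin q → ℝ) (a b : ℝ) :
    jensenGap W p p' a b = ∑ y,
      (a * ((p ᵥ* W) y * Real.log ((p ᵥ* W) y)) + b * ((p' ᵥ* W) y * Real.log ((p' ᵥ* W) y)) -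
        (a * (p ᵥ* W) y + b * (p' ᵥ* W) y) * Real.log (a * (p ᵥ* W) y + b * (p' ᵥ* W) y)) := by
  simp [jensenGap, negEntropy, Matrix.add_vecMul, Matrix.smul_vecMul, Finset.sum_sub_distrib,
    Finset.sum_add_distrib, Finset.mul_sum]

theorem IsStochastic.convex_combination {V₁ V₂ : Matrix (Fin q) (Fin s) ℝ} (h₁ : IsStochastic V₁)
    (h₂ : IsStochastic V₂) {α β : ℝ} (hα : 0 ≤ α) (hβ : 0 ≤ β) (hαβ : α + β = 1) :
    IsStochastic (α • V₁ + β • V₂) :=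
  fun x => convex_stdSimplex ℝ _ (h₁ x) (h₂ x) hα hβ hαβ

theorem LessNoisy.convex_combination [NeZero q] {W : Matrix (Fin q) (Fin r) ℝ}
    {V₁ V₂ : Matrix (Fin q) (Fin s) ℝ} (hW : IsStochastic W) (h₁ : IsStochastic V₁)
    (h₂ : IsStochastic V₂) (hl₁ : LessNoisy W V₁) (hl₂ : LessNoisy W V₂) {α β : ℝ} (hα : 0 ≤ α)
    (hβ : 0 ≤ β) (hαβ : α + β = 1) : LessNoisy W (α • V₁ + β • V₂) := by
  rw [lessNoisy_iff_jensenGap_le hW h₁] at hl₁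
  rw [lessNoisy_iff_jensenGap_le hW h₂] at hl₂
  rw [lessNoisy_iff_jensenGap_le hW (h₁.convex_combination h₂ hα hβ hαβ)]
  intro p hp p' hp' a b ha hb hab
  calc jensenGap (α • V₁ + β • V₂) p p' a b
      ≤ α * jensenGap V₁ p p' a b + β * jensenGap V₂ p p' a b := by
        simp only [jensenGap_eq_sum, Finset.mul_sum]
        rw [← Finset.sum_add_distrib]
        refine Finset.sum_le_sum fun y _ => ?_
        simp only [Matrix.vecMul_add, Matrix.vecMul_smul, Pi.add_apply, Pi.smul_apply,
          smul_eq_mul]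
        exact jensenGap_mul_log_convex ha hb hα hβ ((vecMul_mem_stdSimplex h₁ hp).1 y)
          ((vecMul_mem_stdSimplex h₁ hp').1 y) ((vecMul_mem_stdSimplex h₂ hp).1 y)
          ((vecMul_mem_stdSimplex h₂ hp').1 y)
    _ ≤ α * jensenGap W p p' a b + β * jensenGap W p p' a b := by
        gcongr
        · exact hl₁ p hp p' hp' a b ha hb hab
        · exact hl₂ p hp p' hp' a b ha hb hab
    _ = jensenGap W p p' a b := by rw [← add_mul, hαβ, one_mul]

theorem continuous_jensenGap (p p' : Fin q → ℝ) (a b : ℝ) :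
    Continuous fun V : Matrix (Fin q) (Fin r) ℝ => jensenGap V p p' a b := by
  have h : ∀ (p : Fin q → ℝ) (y : Fin r),
      Continuous fun V : Matrix (Fin q) (Fin r) ℝ => (p ᵥ* V) y := fun p y =>
    (continuous_apply y).comp
      (by fun_prop : Continuous fun V : Matrix (Fin q) (Fin r) ℝ => p ᵥ* V)
  simp only [jensenGap_eq_sum]
  refine continuous_finsetSum _ fun y _ => Continuous.sub (Continuous.add ?_ ?_) ?_
  · exact continuous_const.mul (Real.continuous_mul_log.comp (h p y))
  · exact continuous_const.mul (Real.continuous_mul_log.comp (h p' y))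
  · exact Real.continuous_mul_log.comp
      ((continuous_const.mul (h p y)).add (continuous_const.mul (h p' y)))

end Criterion

/-! ### Hessian conditions for convexity, necessary and sufficient -/

section SecondOrder

variable {q r : ℕ}

theorem hasDerivAt_negEntropy_line {W : Matrix (Fin q) (Fin r) ℝ} {p d : Fin q → ℝ} {t : ℝ}
    (h : ∀ y, (p ᵥ* W) y + t * (d ᵥ* W) y ≠ 0) :
    HasDerivAt (fun t : ℝ => negEntropy W (p + t • d))
      (∑ y, (Real.log ((p ᵥ* W) y + t * (d ᵥ* W) y) + 1) * (d ᵥ* W) y) t := by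
  have hl : ∀ y, HasDerivAt (fun t : ℝ => (p ᵥ* W) y + t * (d ᵥ* W) y) ((d ᵥ* W) y) t := fun y => by
    simpa using ((hasDerivAt_id t).mul_const ((d ᵥ* W) y)).const_add ((p ᵥ* W) y)
  have := HasDerivAt.fun_sum (u := Finset.univ) fun y _ =>
    (Real.hasDerivAt_mul_log (h y)).comp t (hl y)
  simpa [negEntropy, Matrix.add_vecMul, Matrix.smul_vecMul, Function.comp_def] using this

theorem hasDerivAt_deriv_negEntropy_line {W : Matrix (Fin q) (Fin r) ℝ} {p d : Fin q → ℝ} {t : ℝ}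
    (h : ∀ y, (p ᵥ* W) y + t * (d ᵥ* W) y ≠ 0) :
    HasDerivAt (fun t : ℝ => ∑ y, (Real.log ((p ᵥ* W) y + t * (d ᵥ* W) y) + 1) * (d ᵥ* W) y)
      (∑ y, (d ᵥ* W) y ^ 2 / ((p ᵥ* W) y + t * (d ᵥ* W) y)) t := by
  have hl : ∀ y, HasDerivAt (fun t : ℝ => (p ᵥ* W) y + t * (d ᵥ* W) y) ((d ᵥ* W) y) t := fun y => by
    simpa using ((hasDerivAt_id t).mul_const ((d ᵥ* W) y)).const_add ((p ᵥ* W) y)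
  have := HasDerivAt.fun_sum (u := Finset.univ) fun y _ =>
    (((hl y).log (h y)).add_const 1).mul_const ((d ᵥ* W) y)
  convert! this using 2 with y
  ring

/-- If a convex function on an open interval around `0` is twice differentiable at `0`, then its
second derivative there is nonnegative. -/
theorem second_deriv_nonneg_of_convexOn {g g' : ℝ → ℝ} {c ε : ℝ} (hε : 0 < ε)
    (hg : ConvexOn ℝ (Set.Ioo (-ε) ε) g) (hg' : ∀ t ∈ Set.Ioo (-ε) ε, HasDerivAt g (g' t) t)
    (hc : HasDerivAt g' c 0) : 0 ≤ c := by
  have h0 : (0 : ℝ) ∈ Set.Ioo (-ε) ε := ⟨by linarith, hε⟩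
  have hmono : MonotoneOn g' (Set.Ioo (-ε) ε) := by
    have := hg.monotoneOn_deriv fun t ht => (hg' t ht).differentiableAt
    refine this.congr fun t ht => (hg' t ht).deriv
  have hnn : 0 ≤ derivWithin g' (Set.Ioo (-ε) ε) 0 := hmono.derivWithin_nonneg
  rwa [hc.hasDerivWithinAt.derivWithin (isOpen_Ioo.uniqueDiffWithinAt h0)] at hnn

/-- Along the line p + t d the second derivative of the output negative entropy at t = 0 is the sum
of (dW)_y² / (pW)_y; convexity of the difference makes the difference of these forms nonnegative. -/
theorem sum_sq_div_le_of_convexOn {W V : Matrix (Fin q) (Fin r) ℝ} {p d : Fin q → ℝ} {ε : ℝ}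
    (hε : 0 < ε)
    (h : ConvexOn ℝ (stdSimplex ℝ (Fin q)) fun p => negEntropy W p - negEntropy V p)
    (hp : ∀ t ∈ Set.Ioo (-ε) ε, p + t • d ∈ stdSimplex ℝ (Fin q))
    (hW : ∀ t ∈ Set.Ioo (-ε) ε, ∀ y, (p ᵥ* W) y + t * (d ᵥ* W) y ≠ 0)
    (hV : ∀ t ∈ Set.Ioo (-ε) ε, ∀ y, (p ᵥ* V) y + t * (d ᵥ* V) y ≠ 0) :
    ∑ y, (d ᵥ* V) y ^ 2 / (p ᵥ* V) y ≤ ∑ y, (d ᵥ* W) y ^ 2 / (p ᵥ* W) y := by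
  have h0 : (0 : ℝ) ∈ Set.Ioo (-ε) ε := ⟨by linarith, hε⟩
  have hconv : ConvexOn ℝ (Set.Ioo (-ε) ε)
      fun t : ℝ => negEntropy W (p + t • d) - negEntropy V (p + t • d) := by
    refine ⟨convex_Ioo _ _, fun s hs t ht a b ha hb hab => ?_⟩
    have := h.2 (hp s hs) (hp t ht) ha hb hab
    have e : a • (p + s • d) + b • (p + t • d) = p + (a • s + b • t) • d := by
      ext i
      simp only [Pi.add_apply, Pi.smul_apply, smul_eq_mul]
      linear_combination p i * hab
    rwa [e] at this
  have := second_deriv_nonneg_of_convexOn hε hconv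
    (fun t ht => (hasDerivAt_negEntropy_line (hW t ht)).sub (hasDerivAt_negEntropy_line (hV t ht)))
    ((hasDerivAt_deriv_negEntropy_line (hW 0 h0)).sub
      (hasDerivAt_deriv_negEntropy_line (hV 0 h0)))
  simp only [zero_mul, add_zero] at this
  linarith

/-- A sufficient second-order condition for the convexity of a difference of output negative
entropies on the simplex. -/
theorem convexOn_of_sum_sq_div_le (hq : 0 < q) {W V : Matrix (Fin q) (Fin r) ℝ}
    (hW : ∀ p ∈ stdSimplex ℝ (Fin q), (∀ x, 0 < p x) → ∀ y, 0 < (p ᵥ* W) y)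
    (hV : ∀ p ∈ stdSimplex ℝ (Fin q), (∀ x, 0 < p x) → ∀ y, 0 < (p ᵥ* V) y)
    (h : ∀ p ∈ stdSimplex ℝ (Fin q), (∀ x, 0 < p x) → ∀ d : Fin q → ℝ, ∑ x, d x = 0 →
      ∑ y, (d ᵥ* V) y ^ 2 / (p ᵥ* V) y ≤ ∑ y, (d ᵥ* W) y ^ 2 / (p ᵥ* W) y) :
    ConvexOn ℝ (stdSimplex ℝ (Fin q)) fun p => negEntropy W p - negEntropy V p := by
  set G : (Fin q → ℝ) → ℝ := fun p => negEntropy W p - negEntropy V p with hG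
  have hGc : Continuous G := (continuous_negEntropy W).sub (continuous_negEntropy V)
  have interior : ∀ p ∈ stdSimplex ℝ (Fin q), (∀ x, 0 < p x) → ∀ p' ∈ stdSimplex ℝ (Fin q),
      (∀ x, 0 < p' x) → ∀ a b : ℝ, 0 ≤ a → 0 ≤ b → a + b = 1 →
        G (a • p + b • p') ≤ a * G p + b * G p' := by
    intro p hp hp0 p' hp' hp0' a b ha hb hab
    set d := p' - p with hd
    have hd0 : ∑ x, d x = 0 := by simp [hd, hp.2, hp'.2]
    have hline : ∀ t ∈ Set.Icc (0 : ℝ) 1, p + t • d ∈ stdSimplex ℝ (Fin q) ∧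
        ∀ x, 0 < (p + t • d) x := by
      intro t ht
      have e : p + t • d = (1 - t) • p + t • p' := by
        rw [hd]
        module
      refine ⟨e ▸ convex_stdSimplex ℝ _ hp hp' (by linarith [ht.2]) ht.1 (by ring), fun x => ?_⟩
      rw [e]
      exact convex_Ioi (0 : ℝ) (hp0 x) (hp0' x) (by linarith [ht.2]) ht.1 (by ring)
    have hpos : ∀ {U : Matrix (Fin q) (Fin r) ℝ},
        (∀ p ∈ stdSimplex ℝ (Fin q), (∀ x, 0 < p x) → ∀ y, 0 < (p ᵥ* U) y) →
        ∀ t ∈ Set.Icc (0 : ℝ) 1, ∀ y, 0 < (p ᵥ* U) y + t * (d ᵥ* U) y := by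
      intro U hU t ht y
      have := hU _ (hline t ht).1 (hline t ht).2 y
      simpa [Matrix.add_vecMul, Matrix.smul_vecMul] using this
    have hconv : ConvexOn ℝ (Set.Icc (0 : ℝ) 1) fun t : ℝ => G (p + t • d) := by
      refine convexOn_of_hasDerivWithinAt2_nonneg (convex_Icc 0 1) (by fun_prop)
        (fun t ht => HasDerivAt.hasDerivWithinAt <|
          (hasDerivAt_negEntropy_line fun y => (hpos hW t (interior_subset ht) y).ne').sub
          (hasDerivAt_negEntropy_line fun y => (hpos hV t (interior_subset ht) y).ne'))
        (fun t ht => HasDerivAt.hasDerivWithinAt <|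
          (hasDerivAt_deriv_negEntropy_line fun y => (hpos hW t (interior_subset ht) y).ne').sub
          (hasDerivAt_deriv_negEntropy_line fun y => (hpos hV t (interior_subset ht) y).ne'))
        fun t ht => ?_
      have := h _ (hline t (interior_subset ht)).1 (hline t (interior_subset ht)).2 d hd0
      simp only [Matrix.add_vecMul, Matrix.smul_vecMul, Pi.add_apply, Pi.smul_apply,
        smul_eq_mul] at this
      linarith
    have := hconv.2 (x := 0) (by simp) (y := 1) (by simp) ha hb hab
    simp only [smul_eq_mul, mul_zero, mul_one, zero_add, zero_smul, one_smul, add_zero] at this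
    have e : a • p + b • p' = p + b • d := by
      rw [hd, ← eq_sub_iff_add_eq] at *
      subst hab
      module
    have e' : p + d = p' := by simp [hd]
    rw [e' ] at this
    rwa [e]
  refine ⟨convex_stdSimplex ℝ _, fun p hp p' hp' a b ha hb hab => ?_⟩
  have hq' : (0 : ℝ) < q := by exact_mod_cast hq
  -- Entropy is not differentiable at the boundary. Mixing both endpoints with the uniform pmf moves
  -- them into the open simplex, and the inequality survives t → 0+ by continuity.
  let u : Fin q → ℝ := fun _ => 1 / q
  have hu : u ∈ stdSimplex ℝ (Fin q) := ⟨fun _ => by positivity, by simp [u, hq'.ne']⟩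
  let c : (Fin q → ℝ) → ℝ → Fin q → ℝ := fun p t => (1 - t) • p + t • u
  have hc0 : ∀ p, c p 0 = p := fun p => by simp [c]
  have hcc : ∀ p, Continuous (c p) := fun p => by fun_prop
  have hcs : ∀ p ∈ stdSimplex ℝ (Fin q), ∀ t ∈ Set.Ioo (0 : ℝ) 1,
      c p t ∈ stdSimplex ℝ (Fin q) ∧ ∀ x, 0 < c p t x := by
    intro p hp t ht
    refine ⟨convex_stdSimplex ℝ _ hp hu (by linarith [ht.2]) ht.1.le (by ring), fun x => ?_⟩
    have h1 : 0 ≤ (1 - t) * p x := mul_nonneg (by linarith [ht.2]) (hp.1 x)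
    have h2 : 0 < t * (1 / (q : ℝ)) := mul_pos ht.1 (by positivity)
    simpa [c, u] using add_pos_of_nonneg_of_pos h1 h2
  have hlim : ∀ {F : ℝ → ℝ}, Continuous F →
      Filter.Tendsto F (nhdsWithin 0 (Set.Ioi 0)) (nhds (F 0)) :=
    fun hF => hF.continuousAt.tendsto.mono_left nhdsWithin_le_nhds
  have key := le_of_tendsto_of_tendsto
    (hlim (F := fun t => G (a • c p t + b • c p' t))
      (hGc.comp (((hcc p).const_smul a).add ((hcc p').const_smul b))))
    (hlim (F := fun t => a * G (c p t) + b * G (c p' t))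
      ((continuous_const.mul (hGc.comp (hcc p))).add (continuous_const.mul (hGc.comp (hcc p')))))
    (by
      filter_upwards [Ioo_mem_nhdsGT (zero_lt_one' ℝ)] with t ht
      exact interior _ (hcs p hp t ht).1 (hcs p hp t ht).2 _ (hcs p' hp' t ht).1
        (hcs p' hp' t ht).2 a b ha hb hab)
  simpa [hc0] using key

end SecondOrder

/-! ### The Hessian inequality for symmetric channels -/

section SymmetricHessian

/-- Write 1/(n - y) = 1/n + y/(n(n - y)) and use n - y ≥ 1 - Y, valid since n ≥ 1 and y ≤ Y; the
terms 1/n sum to 1. -/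
theorem sum_inv_sub_le {ι : Type*} (S : Finset ι) {n : ℝ} (hn : (S.card : ℝ) = n) (hn1 : 1 ≤ n)
    {y : ι → ℝ} (hy : ∀ i ∈ S, 0 ≤ y i) (hY : ∑ i ∈ S, y i < 1) :
    ∑ i ∈ S, 1 / (n - y i) ≤ 1 / (1 - ∑ i ∈ S, y i) := by
  set Y := ∑ i ∈ S, y i with hYdef
  have hY1 : 0 < 1 - Y := by linarith
  have hn0 : 0 < n := by linarith
  have hY0 : 0 ≤ Y := Finset.sum_nonneg hy
  calc ∑ i ∈ S, 1 / (n - y i) ≤ ∑ i ∈ S, (1 / n + y i / (n * (1 - Y))) := by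
        refine Finset.sum_le_sum fun i hi => ?_
        have hyi : y i ≤ Y := Finset.single_le_sum hy hi
        have hpos : 0 < n - y i := by linarith
        have e : 1 / (n - y i) = 1 / n + y i / (n * (n - y i)) := by
          field_simp
          ring
        rw [e]
        have := hy i hi
        gcongr
    _ = 1 + Y / (n * (1 - Y)) := by
        rw [Finset.sum_add_distrib, ← Finset.sum_div _ y, Finset.sum_const, nsmul_eq_mul, hn,
          mul_one_div, div_self hn0.ne']
    _ ≤ 1 + Y / (1 - Y) := by
        gcongr
        nlinarith
    _ = 1 / (1 - Y) := by
        field_simp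
        ring

/-- The coefficients are v_i/R_i with v_i = n - y_i and R_i > 0. Since the positive y_i sum to n +
1, at most one v_j is negative. As d_j is minus the sum of the other d_i, Cauchy–Schwarz reduces the
claim to the sum of all R_i/v_i being at most 0. -/
theorem sum_sq_mul_div_nonneg {ι : Type*} [Fintype ι] [DecidableEq ι] {n l : ℝ}
    (hn : (Fintype.card ι : ℝ) = n + 1) (hn1 : 1 ≤ n) (hl0 : 0 < l) (hl1 : l ≤ 1) {y d : ι → ℝ}
    (hy : ∀ i, 0 < y i) (hysum : ∑ i, y i = n + 1) (hd : ∑ i, d i = 0) :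
    0 ≤ ∑ i, d i ^ 2 *
      ((n - y i) / ((1 + (n - 1) * l - l * (n - y i)) * (1 + l * (n - y i)))) := by
  set m := 1 + (n - 1) * l with hm
  set R : ι → ℝ := fun i => (m - l * (n - y i)) * (1 + l * (n - y i)) with hR
  have hne : Nontrivial ι := by
    rw [← Fintype.one_lt_card_iff_nontrivial]
    have : (1 : ℝ) < Fintype.card ι := by linarith
    exact_mod_cast this
  have hylt : ∀ i, y i < n + 1 := fun i => by
    obtain ⟨j, hj⟩ := exists_ne i
    rw [← hysum]
    exact Finset.single_lt_sum hj (Finset.mem_univ i) (Finset.mem_univ j) (hy j)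
      fun k _ _ => (hy k).le
  have hRpos : ∀ i, 0 < R i := by
    intro i
    have h1 := hy i
    have h2 := hylt i
    refine mul_pos ?_ ?_
    · rw [hm]
      nlinarith [mul_pos hl0 h1]
    · nlinarith [mul_pos hl0 (sub_pos.2 h2)]
  by_cases hall : ∀ i, 0 ≤ n - y i
  · exact Finset.sum_nonneg fun i _ => mul_nonneg (sq_nonneg _) (div_nonneg (hall i) (hRpos i).le)
  push Not at hall
  obtain ⟨j, hj⟩ := hall
  set S := Finset.univ.erase j with hS
  have hsplit : ∀ f : ι → ℝ, ∑ i, f i = f j + ∑ i ∈ S, f i := fun f =>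
    (Finset.add_sum_erase _ f (Finset.mem_univ j)).symm
  have hYS : ∑ i ∈ S, y i = n + 1 - y j := by
    have := hsplit y
    linarith
  have hcard : (S.card : ℝ) = n := by
    rw [hS, Finset.card_erase_of_mem (Finset.mem_univ j), Finset.card_univ,
      Nat.cast_sub Fintype.card_pos]
    push_cast
    linarith
  have hvpos : ∀ i ∈ S, 0 < n - y i := fun i hi => by
    have := Finset.single_le_sum (fun k _ => (hy k).le) hi
    linarith
  have hinv : ∑ i ∈ S, 1 / (n - y i) ≤ -(1 / (n - y j)) := by
    have := sum_inv_sub_le S hcard hn1 (fun i _ => (hy i).le) (by linarith)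
    rw [hYS] at this
    rwa [show 1 - (n + 1 - y j) = -(n - y j) by ring, one_div_neg_eq_neg_one_div] at this
  have hvne : ∀ i, n - y i ≠ 0 := fun i => by
    by_cases hij : i = j
    · exact hij ▸ hj.ne
    · exact (hvpos i (Finset.mem_erase.2 ⟨hij, Finset.mem_univ i⟩)).ne'
  have hm0 : 0 ≤ m := by
    rw [hm]
    nlinarith
  -- Expanding, R/v = m/v + l(m - 1) - l²v. The last two terms cancel on summation because m - 1 =
  -- (n - 1)l and the y_i sum to n + 1, leaving m times the sum of 1/v_i.
  have hRv : ∑ i, R i / (n - y i) ≤ 0 := by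
    have e : ∀ i, R i / (n - y i) = m * (1 / (n - y i)) + (l * (m - 1) - l ^ 2 * (n - y i)) := by
      intro i
      have := hvne i
      simp only [hR]
      field_simp
      ring
    have h1 : ∑ i, 1 / (n - y i) ≤ 0 := by
      rw [hsplit]
      linarith
    have h2 : ∑ i, (l * (m - 1) - l ^ 2 * (n - y i)) = 0 := by
      have e : ∀ i, l * (m - 1) - l ^ 2 * (n - y i) = -l ^ 2 + l ^ 2 * y i := fun i => by
        rw [hm]
        ring
      simp only [e]
      rw [Finset.sum_add_distrib, ← Finset.mul_sum, hysum]
      simp only [Finset.sum_const, Finset.card_univ, nsmul_eq_mul, hn]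
      ring
    simp only [e]
    rw [Finset.sum_add_distrib, ← Finset.mul_sum, h2, add_zero]
    exact mul_nonpos_of_nonneg_of_nonpos hm0 h1
  rw [hsplit] at hRv ⊢
  rw [hsplit] at hd
  set F := ∑ i ∈ S, d i ^ 2 * ((n - y i) / R i) with hF
  have hF0 : 0 ≤ F := Finset.sum_nonneg fun i hi =>
    mul_nonneg (sq_nonneg _) (div_nonneg (hvpos i hi).le (hRpos i).le)
  have hcs : (∑ i ∈ S, d i) ^ 2 ≤ F * ∑ i ∈ S, R i / (n - y i) := by
    refine Finset.sum_sq_le_sum_mul_sum_of_sq_le_mul S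
      (fun i hi => mul_nonneg (sq_nonneg _) (div_nonneg (hvpos i hi).le (hRpos i).le))
      (fun i hi => div_nonneg (hRpos i).le (hvpos i hi).le) fun i hi => ?_
    have := hvne i
    have := (hRpos i).ne'
    refine le_of_eq ?_
    field_simp
  have hdj : d j ^ 2 ≤ F * (R j / (y j - n)) := by
    have e : R j / (y j - n) = -(R j / (n - y j)) := by
      rw [← div_neg, neg_sub]
    calc d j ^ 2 = (∑ i ∈ S, d i) ^ 2 := by
          rw [show d j = -∑ i ∈ S, d i by linarith]
          ring
      _ ≤ F * ∑ i ∈ S, R i / (n - y i) := hcs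
      _ ≤ F * (R j / (y j - n)) := by
          gcongr
          linarith
  have hpos : 0 < (y j - n) / R j := div_pos (by linarith) (hRpos j)
  have h3 := mul_le_mul_of_nonneg_right hdj hpos.le
  have e4 : F * (R j / (y j - n)) * ((y j - n) / R j) = F := by
    have h5 : y j - n ≠ 0 := by linarith
    have h6 := (hRpos j).ne'
    field_simp
  rw [e4] at h3
  have e5 : d j ^ 2 * ((n - y j) / R j) = -(d j ^ 2 * ((y j - n) / R j)) := by
    rw [← mul_neg, ← neg_div, neg_sub]
  change 0 ≤ d j ^ 2 * ((n - y j) / R j) + F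
  linarith

variable {q : ℕ}

/-- The matrix `l • I + (1 - l) • J`, where `J` has all its entries equal to `1 / q`. -/
noncomputable def symMatrix (q : ℕ) (l : ℝ) : Matrix (Fin q) (Fin q) ℝ :=
  Matrix.of fun a b => l * (if a = b then 1 else 0) + (1 - l) / q

theorem vecMul_symMatrix (l : ℝ) (p : Fin q → ℝ) (y : Fin q) :
    (p ᵥ* symMatrix q l) y = l * p y + (∑ x, p x) * ((1 - l) / q) := by
  simp [Matrix.vecMul, dotProduct, symMatrix, mul_add, Finset.sum_add_distrib, Finset.sum_mul,
    mul_comm]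

theorem convexOn_negEntropy_symMatrix_sub (hq : 2 ≤ q) {l : ℝ} (hl0 : 0 < l) (hl1 : l ≤ 1) :
    ConvexOn ℝ (stdSimplex ℝ (Fin q)) fun p =>
      negEntropy (symMatrix q l) p - negEntropy (symMatrix q (-l / (1 + ((q : ℝ) - 2) * l))) p := by
  have hq2 : (2 : ℝ) ≤ q := by exact_mod_cast hq
  have hq0 : (0 : ℝ) < q := by linarith
  have hm : 0 < 1 + ((q : ℝ) - 2) * l := by nlinarith
  have hlt : ∀ p ∈ stdSimplex ℝ (Fin q), (∀ x, 0 < p x) → ∀ x, p x < 1 := by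
    intro p hp hp0 x
    have : Nontrivial (Fin q) := Fin.nontrivial_iff_two_le.2 hq
    obtain ⟨j, hj⟩ := exists_ne x
    rw [← hp.2]
    exact Finset.single_lt_sum hj (Finset.mem_univ x) (Finset.mem_univ j) (hp0 j)
      fun k _ _ => (hp0 k).le
  have hA : ∀ p ∈ stdSimplex ℝ (Fin q), (∀ x, 0 < p x) → ∀ y, 0 < (p ᵥ* symMatrix q l) y := by
    intro p hp hp0 y
    rw [vecMul_symMatrix, hp.2, one_mul]
    exact add_pos_of_pos_of_nonneg (mul_pos hl0 (hp0 y)) (div_nonneg (by linarith) hq0.le)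
  have hBeq : ∀ p ∈ stdSimplex ℝ (Fin q), ∀ y,
      (p ᵥ* symMatrix q (-l / (1 + ((q : ℝ) - 2) * l))) y =
        (1 + l * (q - 1 - q * p y)) / (q * (1 + ((q : ℝ) - 2) * l)) := by
    intro p hp y
    have hm' := hm.ne'
    rw [vecMul_symMatrix, hp.2, one_mul]
    generalize hD : 1 + ((q : ℝ) - 2) * l = D at hm' ⊢
    field_simp
    rw [← hD]
    ring
  have hBpos : ∀ p ∈ stdSimplex ℝ (Fin q), (∀ x, 0 < p x) → ∀ y,
      0 < 1 + l * ((q : ℝ) - 1 - q * p y) := by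
    intro p hp hp0 y
    nlinarith [mul_pos (mul_pos hl0 hq0) (sub_pos.2 (hlt p hp hp0 y))]
  refine convexOn_of_sum_sq_div_le (by omega) hA (fun p hp hp0 y => ?_) fun p hp hp0 d hd => ?_
  · rw [hBeq p hp]
    exact div_pos (hBpos p hp hp0 y) (mul_pos hq0 hm)
  · have key := sum_sq_mul_div_nonneg (ι := Fin q) (n := (q : ℝ) - 1) (l := l)
      (y := fun x => q * p x) (d := d) (by simp) (by linarith) hl0 hl1
      (fun x => mul_pos hq0 (hp0 x)) (by rw [← Finset.mul_sum, hp.2]; ring) hd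
    rw [← sub_nonneg, ← Finset.sum_sub_distrib]
    -- This constant is the ratio between the difference of the two Hessian forms and the sum in
    -- `sum_sq_mul_div_nonneg`, taken at n = q - 1 and y = qp.
    have hc : 0 ≤ (q : ℝ) * l ^ 3 * (2 + ((q : ℝ) - 2) * l) / (1 + ((q : ℝ) - 2) * l) := by
      have : 0 ≤ 2 + ((q : ℝ) - 2) * l := by linarith
      positivity
    refine (mul_nonneg hc key).trans_eq ?_
    rw [Finset.mul_sum]
    refine Finset.sum_congr rfl fun x _ => ?_
    have hApos := hA p hp hp0 x
    have hBp := (hBpos p hp hp0 x).ne'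
    rw [hBeq p hp]
    rw [vecMul_symMatrix, hp.2, one_mul] at hApos
    simp only [vecMul_symMatrix, hp.2, hd, one_mul, zero_mul, add_zero]
    have eA : l * p x + (1 - l) / q =
        (1 + ((q : ℝ) - 1 - 1) * l - l * (q - 1 - q * p x)) / q := by
      field_simp
      ring
    rw [eA] at hApos ⊢
    have hA' : 1 + ((q : ℝ) - 1 - 1) * l - l * (q - 1 - q * p x) ≠ 0 := by
      intro h0
      rw [h0] at hApos
      simp at hApos
    -- X and Y are the two output probabilities up to positive factors. Since 1 + (q - 2)l = X + Y -
    -- 1, the coefficient identity becomes rational in X, Y and l.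
    generalize hX : 1 + ((q : ℝ) - 1 - 1) * l - l * (q - 1 - q * p x) = X at hA' ⊢
    generalize hY : 1 + l * ((q : ℝ) - 1 - q * p x) = Y at hBp ⊢
    have e1 : l * ((q : ℝ) - 1 - q * p x) = Y - 1 := by rw [← hY]; ring
    have e2 : 1 + ((q : ℝ) - 2) * l = X + Y - 1 := by rw [← hX, ← hY]; ring
    have e3 : 2 + ((q : ℝ) - 2) * l = X + Y := by rw [← hX, ← hY]; ring
    have e4 : ((q : ℝ) - 1 - q * p x) = (Y - 1) / l := by
      rw [← e1]
      field_simp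
    rw [e2] at hm
    rw [e2, e3, e4]
    have hm' := hm.ne'
    have hl' := hl0.ne'
    field_simp
    ring

end SymmetricHessian

/-! ### Symmetric noise, group translations and the degradation region -/

section Noise

variable {q : ℕ}

/-- The mixture with weights `l` and `1 - l` of the point mass at `k` and the uniform pmf. -/
noncomputable def mixNoise (l : ℝ) (k : Fin q) : Fin q → ℝ :=
  fun b => l * (if b = k then 1 else 0) + (1 - l) / q

theorem sum_mixNoise (hq : 0 < q) (l : ℝ) (k : Fin q) : ∑ b, mixNoise l k b = 1 := by
  have hq' : (q : ℝ) ≠ 0 := by positivity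
  simp only [mixNoise, Finset.sum_add_distrib, ← Finset.mul_sum]
  simp
  field_simp
  ring

theorem mixNoise_mem_stdSimplex (hq : 0 < q) {l : ℝ} (k : Fin q) (h0 : 0 ≤ l + (1 - l) / q)
    (h1 : l ≤ 1) : mixNoise l k ∈ stdSimplex ℝ (Fin q) := by
  refine ⟨fun b => ?_, sum_mixNoise hq l k⟩
  unfold mixNoise
  split_ifs
  · simpa using h0
  · simpa using div_nonneg (sub_nonneg.2 h1) (Nat.cast_nonneg q)

theorem symNoise_eq_mixNoise (hq : 2 ≤ q) (δ : ℝ) {k₀ : Fin q} (hk₀ : (k₀ : ℕ) = 0) :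
    symNoise q δ = mixNoise (1 - δ * q / (q - 1)) k₀ := by
  have hq2 : (2 : ℝ) ≤ q := by exact_mod_cast hq
  have h1 : (q : ℝ) - 1 ≠ 0 := by linarith
  have h0 : (q : ℝ) ≠ 0 := by linarith
  ext b
  simp only [symNoise, mixNoise, Fin.ext_iff, hk₀]
  split_ifs
  · field_simp
    ring
  · field_simp
    ring

theorem vecMul_cyclicMatrix (hq : 2 ≤ q) (w : Fin q → ℝ) (b : Fin q) :
    (w ᵥ* cyclicMatrix q) b =
      w ⟨if (b : ℕ) = 0 then q - 1 else b - 1, by have := b.2; split_ifs <;> omega⟩ := by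
  have h : ∀ a : Fin q, (((b : ℕ) : ℤ) - ((a : ℕ) : ℤ) ≡ 1 [ZMOD (q : ℤ)]) ↔
      a = ⟨if (b : ℕ) = 0 then q - 1 else b - 1, by have := b.2; split_ifs <;> omega⟩ := by
    intro a
    have ha := a.2
    have hb := b.2
    rw [Int.modEq_iff_dvd, Fin.ext_iff]
    constructor
    -- The number 1 - b + a lies between 2 - q and q, so its quotient by q is 0 or 1, the latter
    -- only at the wrap-around b = 0, a = q - 1.
    · rintro ⟨c, hc⟩
      have hc1 : c ≤ 1 := by
        by_contra hlt
        have : (q : ℤ) * 2 ≤ q * c := by gcongr; omega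
        omega
      have hc0 : 0 ≤ c := by
        by_contra hlt
        have : (q : ℤ) * c ≤ q * (-1) := by gcongr; omega
        omega
      interval_cases c
      · dsimp only
        split_ifs <;> omega
      · dsimp only
        split_ifs <;> omega
    · dsimp only
      split_ifs with h0
      · intro h
        exact ⟨1, by omega⟩
      · intro h
        exact ⟨0, by omega⟩
  simp [Matrix.vecMul, dotProduct, cyclicMatrix, h]

theorem mixNoise_vecMul_cyclicMatrix_pow (hq : 2 ≤ q) (l : ℝ) {k₀ : Fin q} (hk₀ : (k₀ : ℕ) = 0) :
    ∀ (k : ℕ) (hk : k < q), mixNoise l k₀ ᵥ* (cyclicMatrix q ^ k) = mixNoise l ⟨k, hk⟩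
  | 0, _ => by
    rw [pow_zero, Matrix.vecMul_one]
    exact congrArg _ (Fin.ext hk₀)
  | k + 1, hk => by
    have ih := mixNoise_vecMul_cyclicMatrix_pow hq l hk₀ k (by omega)
    rw [pow_succ, ← Matrix.vecMul_vecMul, ih]
    ext b
    rw [vecMul_cyclicMatrix hq]
    simp only [mixNoise, Fin.ext_iff]
    congr 3
    rw [eq_iff_iff]
    split_ifs <;> omega

theorem cyclicOrbit_symNoise (hq : 2 ≤ q) (δ : ℝ) :
    cyclicOrbit (symNoise q δ) = Set.range (mixNoise (q := q) (1 - δ * q / (q - 1))) := by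
  unfold cyclicOrbit
  congr 1
  funext k
  have h0 : ((⟨0, by omega⟩ : Fin q) : ℕ) = 0 := rfl
  rw [symNoise_eq_mixNoise hq δ h0, mixNoise_vecMul_cyclicMatrix_pow hq _ h0 k k.2]

variable {G : Type*} [AddCommGroup G] (e : Fin q ≃ G)

/-- The permutation `y ↦ y ⊕ g` of the alphabet. -/
def translate (g : G) : Fin q ≃ Fin q := (e.trans (Equiv.addRight g)).trans e.symm

theorem apply_translate (g : G) (y : Fin q) : e (translate e g y) = e y + g := by
  simp [translate]

theorem symm_add_eq_translate (g : G) (y : Fin q) : e.symm (g + e y) = translate e g y := by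
  simp [translate, add_comm]

theorem comp_translate_mem_stdSimplex (g : G) {v : Fin q → ℝ} (hv : v ∈ stdSimplex ℝ (Fin q)) :
    (fun y => v (translate e g y)) ∈ stdSimplex ℝ (Fin q) :=
  ⟨fun _ => hv.1 _, by rw [Equiv.sum_comp (translate e g) v, hv.2]⟩

theorem circ_apply (v : Fin q → ℝ) (a b : Fin q) : circ e v a b = v (translate e (-(e a)) b) := by
  simp [circ, symm_add_eq_translate]

theorem isStochastic_circ {v : Fin q → ℝ} (hv : v ∈ stdSimplex ℝ (Fin q)) :
    IsStochastic (circ e v) := fun x => by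
  have := comp_translate_mem_stdSimplex e (-(e x)) hv
  convert this using 1
  ext y
  exact circ_apply e v x y

theorem circ_add_smul (v w : Fin q → ℝ) (a b : ℝ) :
    circ e (a • v + b • w) = a • circ e v + b • circ e w := by
  ext x y
  simp [circ_apply]

theorem continuous_circ : Continuous (circ e) := by
  refine continuous_pi fun a => continuous_pi fun b => ?_
  simp only [circ_apply]
  exact continuous_apply _

theorem negEntropy_congr {r : ℕ} {W V : Matrix (Fin q) (Fin r) ℝ} (σ : Fin r ≃ Fin r)
    (h : ∀ p y, (p ᵥ* W) y = (p ᵥ* V) (σ y)) : negEntropy W = negEntropy V := by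
  funext p
  simp only [negEntropy, h]
  exact Equiv.sum_comp σ fun y => (p ᵥ* V) y * Real.log ((p ᵥ* V) y)

/-- Up to a relabelling of outputs the channel depends neither on k nor on the group law, so all
entropy computations reduce to `symMatrix`. -/
theorem vecMul_circ_mixNoise (l : ℝ) (k : Fin q) (p : Fin q → ℝ) (y : Fin q) :
    (p ᵥ* circ e (mixNoise l k)) y = (p ᵥ* symMatrix q l) (translate e (-(e k)) y) := by
  have h : ∀ a, translate e (-(e a)) y = k ↔ a = translate e (-(e k)) y := fun a => by
    rw [← e.injective.eq_iff, ← e.injective.eq_iff (a := a), apply_translate, apply_translate]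
    constructor
    · intro h
      rw [← h]
      abel
    · intro h
      rw [h]
      abel
  rw [vecMul_symMatrix]
  simp [Matrix.vecMul, dotProduct, circ_apply, mixNoise, h, mul_add, Finset.sum_add_distrib,
    Finset.sum_mul, mul_comm]

theorem negEntropy_circ_mixNoise (l : ℝ) (k : Fin q) :
    negEntropy (circ e (mixNoise l k)) = negEntropy (symMatrix q l) :=
  negEntropy_congr (translate e (-(e k))) (vecMul_circ_mixNoise e l k)

theorem vecMul_permMatrix (v : Fin q → ℝ) (x y : Fin q) :
    (v ᵥ* permMatrix e x) y = v (translate e (e x) y) := by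
  simp [Matrix.vecMul, dotProduct, permMatrix, symm_add_eq_translate]

theorem negEntropy_circ_vecMul_permMatrix (v : Fin q → ℝ) (x : Fin q) :
    negEntropy (circ e (v ᵥ* permMatrix e x)) = negEntropy (circ e v) := by
  refine negEntropy_congr (translate e (e x)) fun p y => ?_
  simp only [Matrix.vecMul, dotProduct]
  refine Finset.sum_congr rfl fun a _ => ?_
  rw [circ_apply, circ_apply]
  change _ * (v ᵥ* permMatrix e x) _ = _
  rw [vecMul_permMatrix]
  congr 2
  apply e.injective
  simp only [apply_translate]
  abel

theorem vecMul_symMatrix_one (p : Fin q → ℝ) (y : Fin q) : (p ᵥ* symMatrix q 1) y = p y := by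
  simp [vecMul_symMatrix]

theorem circ_mixNoise_mul (l : ℝ) {k₀ : Fin q} (hk₀ : e k₀ = 0) (k : Fin q) :
    circ e (mixNoise l k₀) * circ e (mixNoise 1 k) = circ e (mixNoise l k) := by
  ext a y
  change (circ e (mixNoise l k₀) a ᵥ* circ e (mixNoise 1 k)) y = _
  rw [vecMul_circ_mixNoise, vecMul_symMatrix_one, circ_apply, circ_apply]
  unfold mixNoise
  congr 3
  rw [eq_iff_iff, ← e.injective.eq_iff, ← e.injective.eq_iff]
  simp only [apply_translate, hk₀]
  rw [← sub_eq_zero (b := e k)]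
  refine Eq.congr ?_ rfl
  abel

/-- A degrading matrix A may be averaged over simultaneous translations of inputs and outputs, which
makes it circulant with noise pmf `a`; then v is the mixture of the shifts with weights `a`.
Conversely, a shift is obtained by composing with a permutation channel. -/
theorem addDegradationRegion_circ_mixNoise (hq : 0 < q) (l : ℝ) {k₀ : Fin q} (hk₀ : e k₀ = 0)
    (h0 : 0 ≤ l + (1 - l) / q) (h1 : l ≤ 1) :
    addDegradationRegion e (circ e (mixNoise l k₀)) =
      convexHull ℝ (Set.range (mixNoise (q := q) l)) := by
  have hq' : (q : ℝ) ≠ 0 := by positivity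
  apply Set.Subset.antisymm
  · rintro v ⟨hv, A, hA, hvA⟩
    let a : Fin q → ℝ := fun b => (∑ g, A g (translate e (e g) b)) / q
    have hsum : ∀ b, ∑ g, ∑ i, A i (translate e (e g) b) = q := by
      intro b
      rw [Finset.sum_comm]
      have : ∀ i, ∑ g, A i (translate e (e g) b) = 1 := by
        intro i
        rw [← (hA i).2]
        refine (Equiv.sum_comp (translate e (e b)) (A i)).symm.trans ?_ |>.symm
        refine Finset.sum_congr rfl fun g _ => congrArg _ ?_
        apply e.injective
        simp only [apply_translate]
        abel
      simp [this]
    have hat : ∑ b, a b = 1 := by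
      simp only [a]
      rw [← Finset.sum_div, Finset.sum_comm]
      have : ∀ g, ∑ b, A g (translate e (e g) b) = 1 := fun g => by
        rw [Equiv.sum_comp (translate e (e g)) (A g), (hA g).2]
      simp [this, hq']
    have hva : v = ∑ b, a b • mixNoise l b := by
      ext b
      -- This is entry (g, g ⊕ b) of circ v = W A; averaging it over g gives v b = l a b + (1 -
      -- l)/q.
      have hg : ∀ g, v b = l * A g (translate e (e g) b) +
          (∑ i, A i (translate e (e g) b)) * ((1 - l) / q) := by
        intro g
        have h2 : circ e v g (translate e (e g) b) = v b := by
          rw [circ_apply]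
          congr 1
          apply e.injective
          simp only [apply_translate]
          abel
        rw [← h2, hvA]
        rw [Matrix.mul_apply]
        have h3 : ∀ i, circ e (mixNoise l k₀) g i =
            l * (if i = g then 1 else 0) + (1 - l) / q := by
          intro i
          rw [circ_apply]
          unfold mixNoise
          congr 3
          rw [eq_iff_iff, ← e.injective.eq_iff, ← e.injective.eq_iff (a := i), apply_translate,
            hk₀, ← sub_eq_add_neg, sub_eq_zero]
        simp [h3, add_mul, Finset.sum_add_distrib, ← Finset.mul_sum, mul_comm]
      have h4 : (q : ℝ) * v b = l * (q * a b) + q * ((1 - l) / q) := by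
        calc (q : ℝ) * v b = ∑ _g : Fin q, v b := by simp
          _ = ∑ g, (l * A g (translate e (e g) b) +
                (∑ i, A i (translate e (e g) b)) * ((1 - l) / q)) :=
              Finset.sum_congr rfl fun g _ => hg g
          _ = _ := by
              rw [Finset.sum_add_distrib, ← Finset.mul_sum, ← Finset.sum_mul, hsum]
              simp only [a]
              field_simp
      have h5 : v b = l * a b + (1 - l) / q := by
        apply mul_left_cancel₀ hq'
        rw [h4]
        ring
      rw [h5]
      simp only [Finset.sum_apply, Pi.smul_apply, smul_eq_mul, mixNoise, mul_add,
        Finset.sum_add_distrib, ← Finset.sum_mul, hat, one_mul]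
      simp [mul_comm]
    rw [hva]
    exact (convex_convexHull ℝ _).sum_mem
      (fun b _ => div_nonneg (Finset.sum_nonneg fun g _ => (hA g).1 _) (Nat.cast_nonneg q)) hat
      fun b _ => subset_convexHull ℝ _ ⟨b, rfl⟩
  · refine convexHull_min ?_ ?_
    · rintro _ ⟨k, rfl⟩
      refine ⟨mixNoise_mem_stdSimplex hq k h0 h1, circ e (mixNoise 1 k), ?_, ?_⟩
      · exact isStochastic_circ e (mixNoise_mem_stdSimplex hq k (by simp) le_rfl)
      · exact (circ_mixNoise_mul e l hk₀ k).symm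
    · rintro v ⟨hv, A, hA, hvA⟩ w ⟨hw, B, hB, hwB⟩ a b ha hb hab
      refine ⟨convex_stdSimplex ℝ _ hv hw ha hb hab, a • A + b • B,
        hA.convex_combination hB ha hb hab, ?_⟩
      rw [circ_add_smul, hvA, hwB, Matrix.mul_add, Matrix.mul_smul, Matrix.mul_smul]

end Noise

/-! ### The less noisy region: closure properties, inner and outer bounds -/

section Region

variable {q : ℕ} {G : Type*} [AddCommGroup G] (e : Fin q ≃ G)

theorem lessNoisy_congr [NeZero q] {r s s' : ℕ} {W : Matrix (Fin q) (Fin r) ℝ}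
    {V : Matrix (Fin q) (Fin s) ℝ} {V' : Matrix (Fin q) (Fin s') ℝ} (hW : IsStochastic W)
    (hV : IsStochastic V) (hV' : IsStochastic V') (h : negEntropy V' = negEntropy V)
    (hl : LessNoisy W V) : LessNoisy W V' := by
  rw [lessNoisy_iff_convexOn hW hV] at hl
  rwa [lessNoisy_iff_convexOn hW hV', h]

theorem convex_addLessNoisyRegion [NeZero q] {W : Matrix (Fin q) (Fin q) ℝ}
    (hW : IsStochastic W) : Convex ℝ (addLessNoisyRegion e W) := by
  rintro v ⟨hv, hlv⟩ w ⟨hw, hlw⟩ a b ha hb hab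
  refine ⟨convex_stdSimplex ℝ _ hv hw ha hb hab, ?_⟩
  rw [circ_add_smul]
  exact hlv.convex_combination hW (isStochastic_circ e hv) (isStochastic_circ e hw) hlw ha hb hab

theorem isClosed_addLessNoisyRegion [NeZero q] {W : Matrix (Fin q) (Fin q) ℝ}
    (hW : IsStochastic W) : IsClosed (addLessNoisyRegion e W) := by
  have h : addLessNoisyRegion e W = stdSimplex ℝ (Fin q) ∩
      {v | ∀ p ∈ stdSimplex ℝ (Fin q), ∀ p' ∈ stdSimplex ℝ (Fin q), ∀ a b : ℝ,
        0 ≤ a → 0 ≤ b → a + b = 1 → jensenGap (circ e v) p p' a b ≤ jensenGap W p p' a b} := by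
    ext v
    -- For fixed p, p', a, b the gap inequality is a closed condition on v, so the region is an
    -- intersection of closed sets.
    exact and_congr_right fun hv => lessNoisy_iff_jensenGap_le hW (isStochastic_circ e hv)
  rw [h]
  refine (isClosed_stdSimplex ℝ (Fin q)).inter ?_
  simp only [Set.ofPred_forall]
  refine isClosed_iInter fun p => isClosed_iInter fun _ => isClosed_iInter fun p' =>
    isClosed_iInter fun _ => isClosed_iInter fun a => isClosed_iInter fun b =>
    isClosed_iInter fun _ => isClosed_iInter fun _ => isClosed_iInter fun _ => ?_
  exact isClosed_le ((continuous_jensenGap p p' a b).comp (continuous_circ e)) continuous_const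

theorem vecMul_permMatrix_mem_addLessNoisyRegion [NeZero q] {W : Matrix (Fin q) (Fin q) ℝ}
    (hW : IsStochastic W) {v : Fin q → ℝ} (hv : v ∈ addLessNoisyRegion e W) (x : Fin q) :
    v ᵥ* permMatrix e x ∈ addLessNoisyRegion e W := by
  have hs : v ᵥ* permMatrix e x ∈ stdSimplex ℝ (Fin q) := by
    have := comp_translate_mem_stdSimplex e (e x) hv.1
    simp only [← vecMul_permMatrix] at this
    exact this
  exact ⟨hs, lessNoisy_congr hW (isStochastic_circ e hv.1) (isStochastic_circ e hs)
    (negEntropy_circ_vecMul_permMatrix e v x) hv.2⟩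

theorem uniformPmf_vecMul_circ {v : Fin q → ℝ} (hv : ∑ i, v i = 1) (y : Fin q) :
    (uniformPmf q ᵥ* circ e v) y = 1 / q := by
  simp only [Matrix.vecMul, dotProduct, uniformPmf, circ_apply]
  rw [← Finset.mul_sum]
  have : ∑ a, v (translate e (-(e a)) y) = 1 := by
    rw [← hv]
    refine Equiv.sum_comp ((e.trans (Equiv.subLeft (e y))).trans e.symm) v |>.symm.trans ?_ |>.symm
    refine Finset.sum_congr rfl fun a _ => congrArg _ ?_
    apply e.injective
    simp [apply_translate, sub_eq_add_neg]
  rw [this, mul_one]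

theorem mixNoise_one_vecMul_circ {k₀ : Fin q} (hk₀ : e k₀ = 0) (v : Fin q → ℝ) (y : Fin q) :
    (mixNoise 1 k₀ ᵥ* circ e v) y = v y := by
  simp [Matrix.vecMul, dotProduct, mixNoise, circ_apply, hk₀, translate]

theorem sum_sq_sub_le_of_mem_addLessNoisyRegion (hq : 0 < q) {k₀ : Fin q} (hk₀ : e k₀ = 0)
    {v w : Fin q → ℝ} (hw : w ∈ stdSimplex ℝ (Fin q)) (hv : v ∈ addLessNoisyRegion e (circ e w)) :
    ∑ y, (v y - 1 / q) ^ 2 ≤ ∑ y, (w y - 1 / q) ^ 2 := by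
  have : NeZero q := ⟨hq.ne'⟩
  have hq' : (0 : ℝ) < q := by positivity
  have hconv := (lessNoisy_iff_convexOn (isStochastic_circ e hw) (isStochastic_circ e hv.1)).1 hv.2
  -- The direction from the uniform pmf to the point mass at the identity: its image under circ z is
  -- z - u, while the uniform input has uniform output.
  set d : Fin q → ℝ := mixNoise 1 k₀ - uniformPmf q with hd
  have hdv : ∀ {z : Fin q → ℝ}, z ∈ stdSimplex ℝ (Fin q) → ∀ y,
      (d ᵥ* circ e z) y = z y - 1 / q := by
    intro z hz y
    rw [hd, Matrix.sub_vecMul, Pi.sub_apply, mixNoise_one_vecMul_circ e hk₀,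
      uniformPmf_vecMul_circ e hz.2]
  have hpos : ∀ {z : Fin q → ℝ}, z ∈ stdSimplex ℝ (Fin q) →
      ∀ t ∈ Set.Ioo (-(1 / (q : ℝ))) (1 / q), ∀ y, 0 < 1 / (q : ℝ) + t * (z y - 1 / q) := by
    intro z hz t ht y
    have hz0 := hz.1 y
    have hz1 : z y ≤ 1 := by
      rw [← hz.2]
      exact Finset.single_le_sum (fun i _ => hz.1 i) (Finset.mem_univ y)
    have hq1 : 1 / (q : ℝ) ≤ 1 := by
      rw [div_le_one hq']
      exact_mod_cast hq
    have hqi : 0 < 1 / (q : ℝ) := by positivity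
    rcases le_total 0 t with h | h
    · nlinarith [mul_nonneg h hz0, mul_pos hqi (sub_pos.2 (ht.2.trans_le hq1))]
    · nlinarith [mul_nonneg (neg_nonneg.2 h) (sub_nonneg.2 hz1),
        mul_nonneg (neg_nonneg.2 h) hqi.le, ht.1]
  have hδs : mixNoise 1 k₀ ∈ stdSimplex ℝ (Fin q) :=
    mixNoise_mem_stdSimplex hq k₀ (by simp) le_rfl
  have key := sum_sq_div_le_of_convexOn (p := uniformPmf q) (d := d) (ε := 1 / (q : ℝ))
    (by positivity) hconv
    (fun t ht => ⟨fun y => by simpa [hd, uniformPmf] using (hpos hδs t ht y).le, by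
      simp [hd, uniformPmf, Finset.sum_add_distrib, ← Finset.mul_sum, Finset.sum_sub_distrib,
        hδs.2, hq'.ne']⟩)
    (fun t ht y => by
      rw [uniformPmf_vecMul_circ e hw.2, hdv hw]
      exact (hpos hw t ht y).ne')
    (fun t ht y => by
      rw [uniformPmf_vecMul_circ e hv.1.2, hdv hv.1]
      exact (hpos hv.1 t ht y).ne')
  simp only [hdv hw, hdv hv.1, uniformPmf_vecMul_circ e hw.2, uniformPmf_vecMul_circ e hv.1.2,
    ← Finset.sum_div] at key
  exact (div_le_div_iff_of_pos_right (by positivity)).1 key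

theorem l2norm_sub_uniformPmf_le_iff {v w : Fin q → ℝ} :
    l2norm (v - uniformPmf q) ≤ l2norm (w - uniformPmf q) ↔
      ∑ y, (v y - 1 / q) ^ 2 ≤ ∑ y, (w y - 1 / q) ^ 2 := by
  unfold l2norm
  rw [EuclideanSpace.norm_eq, EuclideanSpace.norm_eq,
    Real.sqrt_le_sqrt_iff (Finset.sum_nonneg fun _ _ => sq_nonneg _)]
  simp [uniformPmf]

theorem mixNoise_mem_addLessNoisyRegion (hq : 2 ≤ q) {l m : ℝ} {k₀ : Fin q} (k : Fin q)
    (hl0 : 0 ≤ l) (hl1 : l ≤ 1) (hm : m = l ∨ m = -l / (1 + ((q : ℝ) - 2) * l)) :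
    mixNoise m k ∈ addLessNoisyRegion e (circ e (mixNoise l k₀)) := by
  have : NeZero q := ⟨by omega⟩
  have hq2 : (2 : ℝ) ≤ q := by exact_mod_cast hq
  have hq0 : (0 : ℝ) < q := by linarith
  have hD : 0 < 1 + ((q : ℝ) - 2) * l := by nlinarith
  have hbase : 0 ≤ l + (1 - l) / q := add_nonneg hl0 (div_nonneg (by linarith) hq0.le)
  have hms : mixNoise m k ∈ stdSimplex ℝ (Fin q) := by
    refine mixNoise_mem_stdSimplex (by omega) k ?_ ?_
    · rcases hm with rfl | rfl
      · exact hbase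
      · have : -l / (1 + ((q : ℝ) - 2) * l) + (1 - -l / (1 + ((q : ℝ) - 2) * l)) / q =
            (1 - l) / (q * (1 + ((q : ℝ) - 2) * l)) := by
          have hD' := hD.ne'
          generalize hE : 1 + ((q : ℝ) - 2) * l = E at hD' ⊢
          field_simp
          rw [← hE]
          ring
        rw [this]
        exact div_nonneg (by linarith) (by positivity)
    · rcases hm with rfl | rfl
      · exact hl1
      · exact (div_nonpos_of_nonpos_of_nonneg (by linarith) hD.le).trans zero_le_one
  refine ⟨hms, ?_⟩
  rw [lessNoisy_iff_convexOn
    (isStochastic_circ e (mixNoise_mem_stdSimplex (by omega) k₀ hbase hl1))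
    (isStochastic_circ e hms), negEntropy_circ_mixNoise, negEntropy_circ_mixNoise]
  by_cases hml : m = l
  · simp only [hml, sub_self]
    exact convexOn_const _ (convex_stdSimplex ℝ _)
  · have hm := hm.resolve_left hml
    have hl : 0 < l := hl0.lt_of_ne fun h => hml (by rw [hm, ← h]; simp)
    rw [hm]
    exact convexOn_negEntropy_symMatrix_sub hq hl hl1

/-- The half-space that separates w_γ from the hull of the shifts of w_δ. -/
theorem le_apply_of_mem_convexHull_mixNoise {l : ℝ} (hl : 0 ≤ l) {v : Fin q → ℝ}
    (hv : v ∈ convexHull ℝ (Set.range (mixNoise (q := q) l))) (y : Fin q) : (1 - l) / q ≤ v y := by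
  have hc : Convex ℝ {v : Fin q → ℝ | (1 - l) / q ≤ v y} :=
    convex_halfSpace_ge (LinearMap.isLinear (LinearMap.proj y : (Fin q → ℝ) →ₗ[ℝ] ℝ)) _
  refine convexHull_min ?_ hc hv
  rintro _ ⟨k, rfl⟩
  simp only [Set.mem_ofPred_eq, mixNoise, le_add_iff_nonneg_left]
  split_ifs <;> simp [hl]

end Region

end NoisyChannel

/-! ### Change of parameters and assembly -/

open NoisyChannel
theorem theorem3 {q : ℕ} (hq : 2 ≤ q) {G : Type*} [AddCommGroup G] (e : Fin q ≃ G)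
    (he : e ⟨0, by omega⟩ = 0) (δ γ : ℝ) (hδ : δ ∈ Set.Icc (0 : ℝ) (((q : ℝ) - 1) / q))
    (hγ : γ = (1 - δ) / (1 - δ + δ / ((q : ℝ) - 1) ^ 2)) :
    addDegradationRegion e (symChannel e δ) = convexHull ℝ (cyclicOrbit (symNoise q δ)) ∧
    convexHull ℝ (cyclicOrbit (symNoise q δ)) ⊆
      convexHull ℝ (cyclicOrbit (symNoise q δ) ∪ cyclicOrbit (symNoise q γ)) ∧
    (3 ≤ q → δ ∈ Set.Ioo (0 : ℝ) (((q : ℝ) - 1) / q) →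
      convexHull ℝ (cyclicOrbit (symNoise q δ)) ⊂
        convexHull ℝ (cyclicOrbit (symNoise q δ) ∪ cyclicOrbit (symNoise q γ))) ∧
    convexHull ℝ (cyclicOrbit (symNoise q δ) ∪ cyclicOrbit (symNoise q γ)) ⊆
      addLessNoisyRegion e (symChannel e δ) ∧
    addLessNoisyRegion e (symChannel e δ) ⊆
      {v | v ∈ stdSimplex ℝ (Fin q) ∧
        l2norm (v - uniformPmf q) ≤ l2norm (symNoise q δ - uniformPmf q)} ∧
    IsClosed (addLessNoisyRegion e (symChannel e δ)) ∧
    Convex ℝ (addLessNoisyRegion e (symChannel e δ)) ∧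
    (∀ v ∈ addLessNoisyRegion e (symChannel e δ), ∀ x : Fin q,
      v ᵥ* permMatrix e x ∈ addLessNoisyRegion e (symChannel e δ)) := by
  have : NeZero q := ⟨by omega⟩
  have hq2 : (2 : ℝ) ≤ q := by exact_mod_cast hq
  have hq0 : (0 : ℝ) < q := by linarith
  have hq1 : (0 : ℝ) < (q : ℝ) - 1 := by linarith
  -- l is the weight of the point mass in w_δ; the interval allowed for δ is exactly 0 ≤ l ≤ 1.
  set l := 1 - δ * q / ((q : ℝ) - 1) with hl
  have hl1 : l ≤ 1 := by
    have : 0 ≤ δ * q / ((q : ℝ) - 1) := div_nonneg (mul_nonneg hδ.1 hq0.le) hq1.le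
    linarith
  have hl0 : 0 ≤ l := by
    rw [hl, sub_nonneg, div_le_one hq1]
    exact (le_div_iff₀ hq0).1 hδ.2
  have hδl : δ = (1 - l) * ((q : ℝ) - 1) / q := by
    rw [hl]
    field_simp
    ring
  have hD : 0 < 1 + ((q : ℝ) - 2) * l := by nlinarith
  have hm : 1 - γ * q / ((q : ℝ) - 1) = -l / (1 + ((q : ℝ) - 2) * l) := by
    have h1 : (1 - δ + δ / ((q : ℝ) - 1) ^ 2) = (1 + ((q : ℝ) - 2) * l) / (q - 1) := by
      rw [hδl]
      field_simp
      ring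
    have h2 : 1 - δ = (1 + (q - 1) * l) / q := by
      rw [hδl]
      field_simp
      ring
    have hD' := hD.ne'
    rw [hγ, h1, h2]
    generalize hE : 1 + ((q : ℝ) - 2) * l = E at hD' ⊢
    field_simp
    rw [← hE]
    ring
  have hbase : 0 ≤ l + (1 - l) / q := add_nonneg hl0 (div_nonneg (by linarith) hq0.le)
  have hws := mixNoise_mem_stdSimplex (by omega) (⟨0, by omega⟩ : Fin q) hbase hl1
  have hW := isStochastic_circ e hws
  unfold symChannel
  rw [cyclicOrbit_symNoise hq, cyclicOrbit_symNoise hq,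
    symNoise_eq_mixNoise hq δ (k₀ := ⟨0, by omega⟩) rfl, ← hl, hm]
  refine ⟨addDegradationRegion_circ_mixNoise e (by omega) l he hbase hl1,
    convexHull_mono Set.subset_union_left, fun hq3 hδ' => ?_, ?_, fun v hv => ⟨hv.1, ?_⟩,
    isClosed_addLessNoisyRegion e hW, convex_addLessNoisyRegion e hW,
    fun v hv x => vecMul_permMatrix_mem_addLessNoisyRegion e hW hv x⟩
  · refine ⟨convexHull_mono Set.subset_union_left, fun hsub => ?_⟩
    have hq3' : (3 : ℝ) ≤ q := by exact_mod_cast hq3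
    have hl0' : 0 < l := by
      rw [hl, sub_pos, div_lt_one hq1]
      exact (lt_div_iff₀ hq0).1 hδ'.2
    have hl1' : l < 1 := by
      have : 0 < δ * q / ((q : ℝ) - 1) := div_pos (mul_pos hδ'.1 hq0) hq1
      linarith
    have hle := le_apply_of_mem_convexHull_mixNoise hl0
      (hsub (subset_convexHull ℝ _ (Or.inr ⟨⟨0, by omega⟩, rfl⟩))) ⟨0, by omega⟩
    -- The coordinate of w_γ at 0 is (1 - l)/q divided by 1 + (q - 2)l, which exceeds 1 once q ≥ 3
    -- and l > 0; so it falls below the minimum (1 - l)/q allowed in the smaller hull.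
    have heq : mixNoise (-l / (1 + ((q : ℝ) - 2) * l)) (⟨0, by omega⟩ : Fin q) ⟨0, by omega⟩ =
        (1 - l) / q / (1 + ((q : ℝ) - 2) * l) := by
      have hD' := hD.ne'
      simp only [mixNoise, if_true]
      generalize hE : 1 + ((q : ℝ) - 2) * l = E at hD' ⊢
      field_simp
      rw [← hE]
      ring
    rw [heq, le_div_iff₀ hD] at hle
    have hpos : 0 < (1 - l) / (q : ℝ) := div_pos (by linarith) hq0
    nlinarith [mul_pos hpos (mul_pos (by linarith : 0 < (q : ℝ) - 2) hl0')]
  · refine convexHull_min ?_ (convex_addLessNoisyRegion e hW)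
    rintro _ (⟨k, rfl⟩ | ⟨k, rfl⟩)
    · exact mixNoise_mem_addLessNoisyRegion e hq k hl0 hl1 (Or.inl rfl)
    · exact mixNoise_mem_addLessNoisyRegion e hq k hl0 hl1 (Or.inr rfl)
  · rw [l2norm_sub_uniformPmf_le_iff]
    exact sum_sq_sub_le_of_mem_addLessNoisyRegion e (by omega) he hws hv
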